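/- Manifolds are smooth ($C^\infty$), Hausdorff, second countable and without boundary, submanifolds are embedded, and codimension of a closed set (or a locally closed set) is measured by Hausdorff dimension, the empty set having every codimension. An $(n-1)$-submanifold $A \subset \mathbb{R}^n$ \emph{nicely bounds} a closed subset $D \subset \mathbb{R}^n$ if 1. $D = \overline{A} - A$; 2. each connected component of $\overline{A}$ contains exactly one connected component of $D$; 3. $D$ is the closure of an $(n-2)$-submanifold $D_0 \subset \mathbb{R}^n$ such that the singular locus $D - D_0$ has codimension at least $4$ in $\mathbb{R}^n$, and $\overline{A}$ is locally diffeomorphic to a half space along $D_0$: every $p \in D_0$ has an open neighbourhood $U$ in $\mathbb{R}^n$ with a diffeomorphism from $U$ onto an open subset of $\mathbb{R}^n$ that carries $\overline{A} \cap U$ and $D_0 \cap U$ to the parts of $\{y_1 = 0,\ y_2 \ge 0\}$ and $\{y_1 = y_2 = 0\}$ in that open subset. **Theorem.** Let $X$ be a connected $n$-manifold with $H_1(X, \mathbb{Z}) = 0$, let $F : X \to \mathbb{R}^n$ be a local diffeomorphism, and let $D \subset \mathbb{R}^n$ be a closed subset of codimension at least two such that the restriction $X - F^{-1}(D) \to \mathbb{R}^n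 - D$ is a $d$-sheeted covering map, where $d$ may be infinite. Suppose that there is an oriented, possibly disconnected, $(n-1)$-submanifold $A \subset \mathbb{R}^n$ that nicely bounds $D$ and for which $\mathbb{R}^n - \overline{A}$ is simply connected. Then $d = 1$ or $d = \infty$. -/

import Mathlib

open scoped Manifold ContDiff Topology ENNReal

noncomputable section

universe u

/-- Euclidean `n`-space. -/
abbrev Eucl (n : ℕ) : Type := EuclideanSpace ℝ (Fin n)

/-- A diffeomorphism between two open subsets of `ℝⁿ` (smooth in both directions). -/
def IsSmoothChart {n : ℕ} (Φ : OpenPartialHomeomorph (Eucl n) (Eucl n)) : Prop :=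
  ContDiffOn ℝ ∞ Φ Φ.source ∧ ContDiffOn ℝ ∞ Φ.symm Φ.target

/-- `S ⊆ ℝⁿ` is a (smooth, embedded, boundaryless) submanifold of codimension `c`, i.e. of
dimension `n - c`: near each of its points there is a diffeomorphism of open sets of `ℝⁿ` that
carries `S` to the coordinate subspace on which `c` distinct coordinates vanish.
(If `c > n` only the empty set qualifies.) -/
def IsSubmanifoldOfCodim {n : ℕ} (c : ℕ) (S : Set (Eucl n)) : Prop :=
  ∀ p ∈ S, ∃ Φ : OpenPartialHomeomorph (Eucl n) (Eucl n),
    IsSmoothChart Φ ∧ p ∈ Φ.source ∧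
    ∃ ι : Fin c ↪ Fin n, ∀ x ∈ Φ.source, x ∈ S ↔ ∀ k, Φ x (ι k) = 0

/-- `S ⊆ ℝⁿ` has codimension at least `c`: it is empty or its (Hausdorff) dimension is at most
`n - c`. -/
def CodimAtLeast {n : ℕ} (c : ℕ) (S : Set (Eucl n)) : Prop :=
  S = ∅ ∨ dimH S + (c : ℝ≥0∞) ≤ (n : ℝ≥0∞)

/-- `B ⊆ ℝⁿ` is, near each point of `D₀`, diffeomorphic to an `(n-1)`-dimensional half space
with edge `D₀`: near `p ∈ D₀` there are a diffeomorphism of open sets of `ℝⁿ` and two distinct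
coordinates `y i`, `y j` such that `B` corresponds to `{y i = 0, y j ≥ 0}` and `D₀` to
`{y i = 0, y j = 0}`. -/
def IsHalfSpaceAlong {n : ℕ} (B D₀ : Set (Eucl n)) : Prop :=
  ∀ p ∈ D₀, ∃ Φ : OpenPartialHomeomorph (Eucl n) (Eucl n),
    IsSmoothChart Φ ∧ p ∈ Φ.source ∧
    ∃ i j : Fin n, i ≠ j ∧
      (∀ x ∈ Φ.source, x ∈ B ↔ Φ x i = 0 ∧ 0 ≤ Φ x j) ∧
      (∀ x ∈ Φ.source, x ∈ D₀ ↔ Φ x i = 0 ∧ Φ x j = 0)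

/-- The `(n-1)`-submanifold `A` of `ℝⁿ` nicely bounds `D`. -/
structure NicelyBounds {n : ℕ} (A D : Set (Eucl n)) : Prop where
  /-- `D` is the frontier `closure A - A` of `A`. -/
  boundary_eq : D = closure A \ A
  /-- Each connected component of `closure A` contains exactly one connected component of `D`. -/
  component : ∀ x ∈ closure A, ∃! C : Set (Eucl n),
    (∃ y ∈ D, C = connectedComponentIn D y) ∧ C ⊆ connectedComponentIn (closure A) x
  /-- `D` is the closure of an `(n-2)`-submanifold `D₀`, the singular locus `D - D₀` has
  codimension at least four, and `closure A` is locally diffeomorphic to a half space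
  along `D₀`. -/
  regular_part : ∃ D₀ : Set (Eucl n), IsSubmanifoldOfCodim 2 D₀ ∧ D = closure D₀ ∧
    CodimAtLeast 4 (D \ D₀) ∧ IsHalfSpaceAlong (closure A) D₀

/-- The tangent space at `p` of a submanifold `A ⊆ ℝⁿ`, as a subspace of `ℝⁿ`: the span of the
limits of rescaled secant vectors of `A` at `p`. -/
def tangentSubspace {n : ℕ} (A : Set (Eucl n)) (p : Eucl n) : Submodule ℝ (Eucl n) :=
  Submodule.span ℝ (tangentConeAt ℝ A p)

/-- The submanifold `A ⊆ ℝⁿ` of dimension `m` admits an orientation: a choice `o` of an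
orientation of every tangent space of `A` which is continuous, in the sense that near every point
of `A` there are continuous vector fields `v 0, …, v (m-1)` that form a positively oriented basis
of the tangent space at every point where they are defined. -/
def IsOrientableSubmanifold {n : ℕ} (m : ℕ) (A : Set (Eucl n)) : Prop :=
  ∃ o : ∀ p : A, Orientation ℝ (tangentSubspace A (p : Eucl n)) (Fin m),
    ∀ p : A, ∃ U ∈ 𝓝 p, ∃ v : Fin m → A → Eucl n,
      (∀ j, ContinuousOn (v j) U) ∧
      ∀ q ∈ U, ∃ b : Module.Basis (Fin m) ℝ (tangentSubspace A (q : Eucl n)),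
        (∀ j, (b j : Eucl n) = v j q) ∧ b.orientation = o q

/-- The first singular homology group with integer coefficients of `X` vanishes. -/
def FirstHomologyVanishes (X : Type u) [TopologicalSpace X] : Prop :=
  CategoryTheory.Limits.IsZero
    (((AlgebraicTopology.singularHomologyFunctor.{u} AddCommGrpCat.{u} 1).obj
      (AddCommGrpCat.of (ULift.{u} ℤ))).obj (TopCat.of X))

/-- `F : X → Y` is a `d`-sheeted covering map away from `D ⊆ Y`. -/
structure IsSheetedCoverAwayFrom {X Y : Type*} [TopologicalSpace X] [TopologicalSpace Y]
    (F : X → Y) (d : ℕ∞) (D : Set Y) : Prop where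
  covering : IsCoveringMap (Dᶜ.restrictPreimage F)
  sheets : ∀ y ∉ D, (F ⁻¹' {y}).encard = d

end

/-! Let `d` be finite and let `C` be the complement of `closure A`. Since `C` is simply connected,
`F⁻¹(C)` splits into `d` sheets, named by the points over a base point `b` (`exists_isSheetLabel`).
The orientation of `A` yields a coorientation (`exists_isCoorientation`), hence at each point over
`A` the labels `lp`, `lm` of the sheets on its positive and negative side.

The heart is `lp = lm` (`side_labels_eq_of_homology`). Fix a label `i` and let `T` be the set of
points over `A` with `lp = i ≠ lm`. It is open in `F⁻¹(A)`, and closed away from the preimage of the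
singular locus: near `D₀` the complement of `closure A` is connected, which forces `lp = lm`. So `T`
is a closed cooriented hypersurface off a set of codimension greater than two, and `H₁(X) = 0` makes
crossing number with `T` a coboundary: some `H : X → ℤ` is locally constant over `C`, jumps by 1
across `T` and by 0 across the rest of `F⁻¹(A)`. The sum of `H` over a fibre is constant on the
connected set `C`, yet crossing `A` at `a` changes it by the number of points of `T` over `a`. Hence
`T` is empty.

Once `lp = lm`, the indicator of a sheet extends locally constantly over `A`, then over `D` by
codimension two, so there is only one sheet (`subsingleton_fiber_of_side_labels_eq`).

To construct `H`, local models are glued: their differences form a local cocycle, integrated by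
`IsLocCocycle.exists_primitive`; `exists_agreesAt_near` supplies models at the singular locus. -/

/-! ### Local integral cocycles and their primitives over simply connected spaces. -/

section

open Set Filter

/-- A locally defined integral `1`-cocycle on a topological space. -/
def IsLocCocycle {X : Type*} [TopologicalSpace X] (φ : X → X → ℤ) : Prop :=
  ∀ x, ∀ᶠ y in 𝓝 x, ∀ᶠ z in 𝓝 y, φ x z = φ x y + φ y z

/-- `k` is a primitive along `f` of the local cocycle `φ`. -/
def IsCocycleLift {X Z : Type*} [TopologicalSpace Z] (φ : X → X → ℤ) (f : Z → X) (k : Z → ℤ) :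
    Prop :=
  ∀ z, ∀ᶠ w in 𝓝 z, k w = k z + φ (f z) (f w)

namespace IsLocCocycle

variable {X : Type*} [TopologicalSpace X] {φ : X → X → ℤ}

theorem apply_self (hφ : IsLocCocycle φ) (x : X) : φ x x = 0 := by
  have := (hφ x).self_of_nhds.self_of_nhds
  omega

/-- The fibre bundle with fibre `ℤ` attached to a local cocycle. -/
noncomputable def bundleCore (hφ : IsLocCocycle φ) : FiberBundleCore X X ℤ where
  baseSet x := interior {y | ∀ᶠ z in 𝓝 y, φ x z = φ x y + φ y z}
  isOpen_baseSet _ := isOpen_interior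
  indexAt := id
  mem_baseSet_at x := mem_interior_iff_mem_nhds.2 (hφ x)
  coordChange x x' b k := k + φ x b - φ x' b
  coordChange_self _ _ _ _ := by ring
  continuousOn_coordChange x x' := by
    rintro ⟨b, k⟩ ⟨⟨hb, hb'⟩, -⟩
    replace hb : b ∈ {y | ∀ᶠ z in 𝓝 y, φ x z = φ x y + φ y z} := interior_subset hb
    replace hb' : b ∈ {y | ∀ᶠ z in 𝓝 y, φ x' z = φ x' y + φ y z} := interior_subset hb'
    rw [mem_ofPred_eq] at hb hb'
    refine ContinuousAt.continuousWithinAt ?_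
    have : ContinuousAt (fun p : X × ℤ => p.2 + φ x b - φ x' b) (b, k) :=
      (by fun_prop : Continuous fun p : X × ℤ => p.2 + φ x b - φ x' b).continuousAt
    refine this.congr ?_
    -- Near `b` both terms acquire the same summand `φ b p.1`, which cancels: the transition
    -- function is locally constant.
    filter_upwards [continuousAt_fst.eventually hb, continuousAt_fst.eventually hb'] with p e1 e2
    rw [e1, e2]; ring
  coordChange_comp _ _ _ _ _ _ := by ring

/-- The bundle is a covering, so `f` lifts to it. The primitive is the fibre coordinate of the lift,
read at each point in the chart centred there; passing to the chart at `f z` produces the term `φ (f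
z) (f w)`. -/
theorem exists_lift (hφ : IsLocCocycle φ) {Z : Type*} [TopologicalSpace Z]
    [SimplyConnectedSpace Z] [LocallyPathConnectedSpace Z] (f : C(Z, X)) :
    ∃ k, IsCocycleLift φ f k := by
  have hcov : IsCoveringMap (Bundle.TotalSpace.proj (F := ℤ) (E := hφ.bundleCore.Fiber)) :=
    FiberBundle.isCoveringMap
  obtain ⟨z₀⟩ : Nonempty Z := inferInstance
  obtain ⟨g, ⟨-, hg⟩, -⟩ := hcov.existsUnique_continuousMap_lifts f z₀
    (⟨f z₀, (0 : ℤ)⟩ : hφ.bundleCore.TotalSpace) rfl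
  have hg' : ∀ z, (g z).1 = f z := fun z => congrFun hg z
  let k : Z → ℤ := fun z => (g z).2
  refine ⟨k, fun z => ?_⟩
  set T := hφ.bundleCore.localTrivAt (f z)
  have hz : g z ∈ T.source := by
    rw [FiberBundleCore.mem_localTrivAt_source, hg']
    exact hφ.bundleCore.mem_baseSet_at (f z)
  have hc : ContinuousAt (fun w => (T (g w)).2) z :=
    continuousAt_snd.comp ((T.continuousAt hz).comp g.continuous.continuousAt)
  have hev : ∀ᶠ w in 𝓝 z, (T (g w)).2 = (T (g z)).2 :=
    hc.eventually (isOpen_discrete {(T (g z)).2} |>.mem_nhds rfl)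
  have key : ∀ w, (T (g w)).2 = k w + φ (g w).1 (g w).1 - φ (f z) (g w).1 := fun w => rfl
  filter_upwards [hev] with w hw
  rw [key, key, hφ.apply_self, hφ.apply_self, hg', hg', hφ.apply_self] at hw
  omega

end IsLocCocycle

theorem IsCocycleLift.comp {X Z W : Type*} [TopologicalSpace Z] [TopologicalSpace W]
    {φ : X → X → ℤ} {f : Z → X} {k : Z → ℤ} (h : IsCocycleLift φ f k) {g : W → Z}
    (hg : Continuous g) : IsCocycleLift φ (f ∘ g) (k ∘ g) :=
  fun w => hg.continuousAt.eventually (h (g w))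

theorem IsCocycleLift.sub_eq_sub {X Z : Type*} [TopologicalSpace Z] [PreconnectedSpace Z]
    {φ : X → X → ℤ} {f : Z → X} {k k' : Z → ℤ} (h : IsCocycleLift φ f k)
    (h' : IsCocycleLift φ f k') (a b : Z) : k b - k a = k' b - k' a := by
  have : IsLocallyConstant fun z => k z - k' z := by
    rw [IsLocallyConstant.iff_eventually_eq]
    intro z
    filter_upwards [h z, h' z] with w e e'
    omega
  have := this.apply_eq_of_preconnectedSpace a b
  omega

end

/-! ### Pairing cocycles with singular homology: primitives when `H₁ = 0`. -/

section

open Set Filter CategoryTheory Limits Simplicial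

/-- A cycle factors through the cycles and a cocycle through the opcycles, so their pairing passes
through homology. -/
theorem HomologicalComplex.comp_eq_zero_of_isZero_homology {C ι : Type*} [Category C]
    [Preadditive C] [CategoryWithHomology C] {c : ComplexShape ι} (K : HomologicalComplex C c)
    {i j k : ι} (hi : c.prev j = i) (hk : c.next j = k) (hK : IsZero (K.homology j)) {R T : C}
    (z : R ⟶ K.X j) (hz : z ≫ K.d j k = 0) (f : K.X j ⟶ T) (hf : K.d i j ≫ f = 0) :
    z ≫ f = 0 := by
  rw [← K.liftCycles_i z k hk hz, ← K.p_descOpcycles f i hi hf, Category.assoc,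
    ← Category.assoc (K.iCycles j), ← K.homology_π_ι, hK.eq_zero_of_tgt (K.homologyπ j)]
  simp

instance stdSimplex_locallyPathConnectedSpace (n : ℕ) :
    LocallyPathConnectedSpace (stdSimplex ℝ (Fin n)) :=
  (convex_stdSimplex ℝ (Fin n)).locallyPathConnectedSpace

instance stdSimplex_contractibleSpace (n : ℕ) :
    ContractibleSpace (stdSimplex ℝ (Fin (n + 1))) :=
  (convex_stdSimplex ℝ (Fin (n + 1))).contractibleSpace ⟨_, single_mem_stdSimplex ℝ 0⟩

namespace IsLocCocycle

variable {X : Type u} [TopologicalSpace X] {φ : X → X → ℤ}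

/-- The integral of a local cocycle over a singular `1`-simplex. -/
noncomputable def integral (hφ : IsLocCocycle φ) (σ : C(stdSimplex ℝ (Fin 2), X)) : ℤ :=
  (hφ.exists_lift σ).choose (stdSimplex.vertex 1) - (hφ.exists_lift σ).choose (stdSimplex.vertex 0)

theorem integral_eq (hφ : IsLocCocycle φ) (σ : C(stdSimplex ℝ (Fin 2), X))
    {k : stdSimplex ℝ (Fin 2) → ℤ} (hk : IsCocycleLift φ σ k) :
    hφ.integral σ = k (stdSimplex.vertex 1) - k (stdSimplex.vertex 0) :=
  (hφ.exists_lift σ).choose_spec.sub_eq_sub hk _ _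

/-- The `i`-th face of a singular simplex. -/
noncomputable def _root_.ContinuousMap.simplexFace {n : ℕ}
    (τ : C(stdSimplex ℝ (Fin (n + 2)), X)) (i : Fin (n + 2)) : C(stdSimplex ℝ (Fin (n + 1)), X) :=
  τ.comp ⟨stdSimplex.map i.succAbove, stdSimplex.continuous_map _⟩

/-- A primitive on the whole triangle restricts to its edges, and the vertex differences telescope.
-/
theorem integral_boundary (hφ : IsLocCocycle φ) (τ : C(stdSimplex ℝ (Fin 3), X)) :
    hφ.integral (τ.simplexFace 0) - hφ.integral (τ.simplexFace 1)
      + hφ.integral (τ.simplexFace 2) = 0 := by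
  obtain ⟨k, hk⟩ := hφ.exists_lift τ
  have key : ∀ i : Fin 3, hφ.integral (τ.simplexFace i)
      = k (stdSimplex.vertex (i.succAbove 1)) - k (stdSimplex.vertex (i.succAbove 0)) := by
    intro i
    rw [hφ.integral_eq _ (hk.comp (stdSimplex.continuous_map i.succAbove))]
    simp [stdSimplex.map_vertex]
  rw [key, key, key]
  have h1 : (0 : Fin 3).succAbove (1 : Fin 2) = 2 := rfl
  have h2 : (0 : Fin 3).succAbove (0 : Fin 2) = 1 := rfl
  have h3 : (1 : Fin 3).succAbove (1 : Fin 2) = 2 := rfl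
  have h4 : (1 : Fin 3).succAbove (0 : Fin 2) = 0 := rfl
  have h5 : (2 : Fin 3).succAbove (1 : Fin 2) = 1 := rfl
  have h6 : (2 : Fin 3).succAbove (0 : Fin 2) = 0 := rfl
  rw [h1, h2, h3, h4, h5, h6]
  ring

end IsLocCocycle

theorem TopCat.toSSet_δ_symm (X : TopCat.{u}) {n : ℕ} (i : Fin (n + 2))
    (τ : C(stdSimplex ℝ (Fin (n + 2)), X)) :
    (TopCat.toSSet.obj X).δ i ((X.toSSetObjEquiv (.op ⦋n + 1⦌)).symm τ)
      = (X.toSSetObjEquiv (.op ⦋n⦌)).symm (τ.simplexFace i) :=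
  TopCat.toSSetObjEquiv_symm_naturality (X := X) (SimplexCategory.δ i) τ

theorem AddCommGrpCat.zsmul_id_eq_zero {m : ℤ}
    (h : m • 𝟙 (AddCommGrpCat.of (ULift.{u} ℤ)) = 0) : m = 0 := by
  have := congrArg (fun g : AddCommGrpCat.of (ULift.{u} ℤ) ⟶ AddCommGrpCat.of (ULift.{u} ℤ) =>
    (g.hom (ULift.up 1 : ULift.{u} ℤ) : ULift.{u} ℤ).down) h
  change m • (1 : ℤ) = 0 at this
  simpa using this

namespace IsLocCocycle

variable {X : Type u} [TopologicalSpace X] {φ : X → X → ℤ}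

/-- Face 0 is the end point and face 1 the starting point, so the hypotheses make `a + b - e` a
cycle; the integral, a cocycle, pairs to zero with it. -/
theorem integral_add_eq (hφ : IsLocCocycle φ) (hX : FirstHomologyVanishes X)
    (a b e : C(stdSimplex ℝ (Fin 2), X)) (h1 : a.simplexFace 0 = b.simplexFace 1)
    (h2 : a.simplexFace 1 = e.simplexFace 1) (h3 : b.simplexFace 0 = e.simplexFace 0) :
    hφ.integral a + hφ.integral b = hφ.integral e := by
  let R : AddCommGrpCat.{u} := AddCommGrpCat.of (ULift.{u} ℤ)
  let S : SSet.{u} := TopCat.toSSet.obj (TopCat.of X)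
  let E (n : ℕ) : S _⦋n⦌ ≃ C(stdSimplex ℝ (Fin (n + 1)), X) :=
    (TopCat.of X).toSSetObjEquiv (.op ⦋n⦌)
  have hδ : ∀ (n : ℕ) (i : Fin (n + 2)) (τ : C(stdSimplex ℝ (Fin (n + 2)), X)),
      S.δ i ((E (n + 1)).symm τ) = (E n).symm (τ.simplexFace i) :=
    fun n i τ => TopCat.toSSet_δ_symm (TopCat.of X) i τ
  let f : (S.chainComplex R).X 1 ⟶ R :=
    (S.isColimitChainComplexXCofan R 1).desc (Cofan.mk R fun x => hφ.integral (E 1 x) • 𝟙 R)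
  have hf : ∀ σ, S.ιChainComplex ((E 1).symm σ) ≫ f = hφ.integral σ • 𝟙 R := by
    intro σ
    refine ((S.isColimitChainComplexXCofan R 1).fac _ ⟨(E 1).symm σ⟩).trans ?_
    simp
  have hX' : IsZero ((S.chainComplex R).homology 1) := hX
  let z : R ⟶ (S.chainComplex R).X 1 := S.ιChainComplex ((E 1).symm a)
    + S.ιChainComplex ((E 1).symm b) - S.ιChainComplex ((E 1).symm e)
  have hz : z ≫ (S.chainComplex R).d 1 0 = 0 := by
    simp only [z, Preadditive.add_comp, Preadditive.sub_comp, SSet.ιChainComplex_d,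
      hδ]
    simp only [Fin.sum_univ_succ]
    simp [h1, h2, h3]
    abel
  have hd : (S.chainComplex R).d 2 1 ≫ f = 0 := by
    refine SSet.chainComplex_hom_ext fun x => ?_
    obtain ⟨τ, rfl⟩ := (E 2).symm.surjective x
    rw [SSet.ιChainComplex_d_assoc]
    simp only [Preadditive.sum_comp, Preadditive.zsmul_comp, hδ, hf]
    have := hφ.integral_boundary τ
    simp only [Fin.sum_univ_succ]
    simp
    rw [← neg_smul, ← add_smul, ← add_smul]
    rw [show ∀ p q r : ℤ, p + (-q + r) = p - q + r by intros; ring, this, zero_smul]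
  have h0 := (S.chainComplex R).comp_eq_zero_of_isZero_homology (i := 2) (j := 1) (k := 0)
    (by simp) (by simp) hX' z hz f hd
  simp only [z, Preadditive.add_comp, Preadditive.sub_comp, hf, ← add_smul, ← sub_smul] at h0
  have h4 := AddCommGrpCat.zsmul_id_eq_zero h0
  omega

/-- The singular `1`-simplex of a path. -/
noncomputable def _root_.Path.toSimplex {x y : X} (γ : Path x y) : C(stdSimplex ℝ (Fin 2), X) :=
  γ.toContinuousMap.comp ⟨stdSimplexHomeomorphUnitInterval, by fun_prop⟩

theorem _root_.ContinuousMap.simplexFace_eq (σ : C(stdSimplex ℝ (Fin 2), X)) (i : Fin 2) :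
    σ.simplexFace i = ContinuousMap.const _ (σ (stdSimplex.vertex (i.succAbove 0))) := by
  ext p
  obtain rfl : p = stdSimplex.vertex 0 := Subsingleton.elim _ _
  simp [ContinuousMap.simplexFace, stdSimplex.map_vertex]

theorem _root_.Path.toSimplex_zero {x y : X} (γ : Path x y) :
    γ.toSimplex (stdSimplex.vertex 0) = x := by
  simp [Path.toSimplex]

theorem _root_.Path.toSimplex_one {x y : X} (γ : Path x y) :
    γ.toSimplex (stdSimplex.vertex 1) = y := by
  simp [Path.toSimplex]

/-- The primitive integrates `φ` along a chosen path from `x₀`; `integral_add_eq` makes the choices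
harmless. -/
theorem exists_primitive [PathConnectedSpace X] [LocallyPathConnectedSpace X]
    (hφ : IsLocCocycle φ) (hX : FirstHomologyVanishes X) : ∃ K : X → ℤ, IsCocycleLift φ id K := by
  obtain ⟨x₀⟩ : Nonempty X := inferInstance
  let γ (x : X) : Path x₀ x := (PathConnectedSpace.joined x₀ x).somePath
  refine ⟨fun x => hφ.integral (γ x).toSimplex, fun x => ?_⟩
  obtain ⟨V, ⟨hV, hVc⟩, hVU⟩ := (path_connected_basis x).mem_iff.1 (hφ x)
  filter_upwards [hV] with y hy
  obtain ⟨δ, hδ⟩ := hVc.joinedIn x (mem_of_mem_nhds hV) y hy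
  -- As `δ` stays where the cocycle relation based at `x` holds, `φ x` is itself a primitive along
  -- `δ`.
  have hlift : IsCocycleLift φ δ.toSimplex fun t => φ x (δ.toSimplex t) := by
    intro t
    have : ∀ᶠ z in 𝓝 (δ.toSimplex t), φ x z = φ x (δ.toSimplex t) + φ (δ.toSimplex t) z :=
      hVU (hδ _)
    exact δ.toSimplex.continuous.continuousAt.eventually this
  have h1 := hφ.integral_eq _ hlift
  rw [Path.toSimplex_zero, Path.toSimplex_one, hφ.apply_self, sub_zero] at h1
  have h2 := hφ.integral_add_eq hX (γ x).toSimplex δ.toSimplex (γ y).toSimplex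
    (by simp [ContinuousMap.simplexFace_eq, Path.toSimplex_zero, Path.toSimplex_one])
    (by simp [ContinuousMap.simplexFace_eq, Path.toSimplex_zero])
    (by simp [ContinuousMap.simplexFace_eq, Path.toSimplex_one])
  simp only [id]
  omega

end IsLocCocycle

end

/-! ### Gluing integer functions known up to local constants. -/

section

open Set Filter

/-- Two integer valued functions differ by a constant on the part of `Y` near `b`. -/
def AgreesAt {X : Type*} [TopologicalSpace X] (Y : Set X) (g h : X → ℤ) (b : X) : Prop :=
  ∃ c : ℤ, ∀ᶠ z in 𝓝[Y] b, g z - h z = c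

section AgreesAt

variable {X : Type*} [TopologicalSpace X] {Y : Set X} {g h k : X → ℤ} {b : X}

theorem AgreesAt.refl (Y : Set X) (g : X → ℤ) (b : X) : AgreesAt Y g g b :=
  ⟨0, .of_forall fun _ => sub_self _⟩

theorem AgreesAt.symm (H : AgreesAt Y g h b) : AgreesAt Y h g b := by
  obtain ⟨c, hc⟩ := H
  exact ⟨-c, hc.mono fun z hz => by omega⟩

theorem AgreesAt.trans (H : AgreesAt Y g h b) (H' : AgreesAt Y h k b) : AgreesAt Y g k b := by
  obtain ⟨c, hc⟩ := H
  obtain ⟨c', hc'⟩ := H'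
  exact ⟨c + c', by filter_upwards [hc, hc'] with z h1 h2; omega⟩

theorem Dense.nhdsWithin_neBot (hY : Dense Y) (b : X) : (𝓝[Y] b).NeBot :=
  mem_closure_iff_nhdsWithin_neBot.1 (hY b)

/-- Density of `Y` makes the local constant unique, hence locally constant in the base point. -/
theorem exists_sub_eq_of_agreesAt (hY : Dense Y) {O : Set X} (hO : IsPreconnected O)
    (H : ∀ b ∈ O, AgreesAt Y g h b) : ∃ c : ℤ, ∀ z ∈ O, z ∈ Y → g z - h z = c := by
  choose! c hc using H
  have hO' : PreconnectedSpace O := isPreconnected_iff_preconnectedSpace.1 hO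
  have hloc : IsLocallyConstant fun z : O => c z := by
    rw [IsLocallyConstant.iff_eventually_eq]
    intro z
    filter_upwards [continuousAt_subtype_val.eventually
      (eventually_nhds_nhdsWithin.2 (hc z z.2))] with w hw
    have := hY.nhdsWithin_neBot (w : X)
    obtain ⟨y, h1, h2⟩ := (hw.and (hc w w.2)).exists
    exact h2.symm.trans h1
  have hself : ∀ z ∈ O, z ∈ Y → g z - h z = c z := fun z hz hzY =>
    (hc z hz).self_of_nhdsWithin hzY
  rcases O.eq_empty_or_nonempty with rfl | ⟨o, ho⟩
  · exact ⟨0, by simp⟩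
  · exact ⟨c o, fun z hz hzY => (hself z hz hzY).trans
      (hloc.apply_eq_of_preconnectedSpace ⟨z, hz⟩ ⟨o, ho⟩)⟩

open Classical in
/-- The constant by which two functions differ near a point. -/
noncomputable def localJump (Y : Set X) (h : X → X → ℤ) (x y : X) : ℤ :=
  if H : AgreesAt Y (h x) (h y) y then H.choose else 0

theorem localJump_spec {h : X → X → ℤ} {x y : X} (H : AgreesAt Y (h x) (h y) y) :
    ∀ᶠ z in 𝓝[Y] y, h x z - h y z = localJump Y h x y := by
  rw [localJump, dif_pos H]
  exact H.choose_spec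

theorem eventually_localJump_add (hY : Dense Y) {h : X → X → ℤ} {x : X}
    (hx : ∀ᶠ y in 𝓝 x, AgreesAt Y (h x) (h y) y ∧ ∀ᶠ z in 𝓝 y, AgreesAt Y (h y) (h z) z) :
    ∀ᶠ y in 𝓝 x, ∀ᶠ z in 𝓝 y,
      localJump Y h x z = localJump Y h x y + localJump Y h y z := by
  filter_upwards [hx.eventually_nhds] with y hy
  filter_upwards [hy, hy.self_of_nhds.2,
    eventually_nhds_nhdsWithin.2 (localJump_spec hy.self_of_nhds.1)] with z h1 h2 h3
  have := hY.nhdsWithin_neBot z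
  obtain ⟨w, e1, e2, e3⟩ := ((localJump_spec h1.1).and ((localJump_spec h2).and h3)).exists
  omega

/-- For `z ∈ Y` near `b`, the jump added to `K b` is `h b z - h z z`, so the diagonal term cancels.
-/
theorem agreesAt_of_isCocycleLift {h : X → X → ℤ} {K : X → ℤ} {b : X}
    (hb : ∀ᶠ z in 𝓝 b, AgreesAt Y (h b) (h z) z)
    (hK : ∀ᶠ z in 𝓝 b, K z = K b + localJump Y h b z) :
    AgreesAt Y (fun z => K z + h z z) (h b) b := by
  refine ⟨K b, ?_⟩
  filter_upwards [mem_nhdsWithin_of_mem_nhds hb, mem_nhdsWithin_of_mem_nhds hK,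
    self_mem_nhdsWithin] with z h1 h2 h3
  have h4 := (localJump_spec h1).self_of_nhdsWithin h3
  omega

theorem exists_agreesAt_of_simplyConnected [LocallyPathConnectedSpace X] (hY : Dense Y)
    {h : X → X → ℤ} {O : Set X} (hO : IsOpen O) (hOs : SimplyConnectedSpace O)
    (hh : ∀ x ∈ O, ∀ᶠ y in 𝓝 x, AgreesAt Y (h x) (h y) y) :
    ∃ g : X → ℤ, ∀ b ∈ O, AgreesAt Y g (h b) b := by
  have hloc : IsLocCocycle fun x y : O => localJump Y h x y := by
    intro x
    have h1 : ∀ᶠ y in 𝓝 (x : X), AgreesAt Y (h x) (h y) y ∧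
        ∀ᶠ z in 𝓝 y, AgreesAt Y (h y) (h z) z := by
      filter_upwards [hh x x.2, hO.mem_nhds x.2] with y h1 h2
      exact ⟨h1, hh y h2⟩
    filter_upwards [continuousAt_subtype_val.eventually (eventually_localJump_add hY h1)] with y hy
    exact continuousAt_subtype_val.eventually hy
  have := hO.locallyPathConnectedSpace
  obtain ⟨K, hK⟩ := hloc.exists_lift (ContinuousMap.id O)
  classical
  let K' : X → ℤ := fun x => if hx : x ∈ O then K ⟨x, hx⟩ else 0
  refine ⟨fun z => K' z + h z z, fun b hb => agreesAt_of_isCocycleLift (hh b hb) ?_⟩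
  have h2 := hK ⟨b, hb⟩
  rw [nhds_subtype_eq_comap, eventually_comap] at h2
  filter_upwards [h2, hO.mem_nhds hb] with z hz hzO
  have := hz ⟨z, hzO⟩ rfl
  simpa [K', hb, hzO] using this

end AgreesAt

theorem exists_agreesAt_of_homology {X : Type u} [TopologicalSpace X] [PathConnectedSpace X]
    [LocallyPathConnectedSpace X] (hX : FirstHomologyVanishes X) {Y : Set X} (hY : Dense Y)
    {h : X → X → ℤ} (hh : ∀ x, ∀ᶠ y in 𝓝 x, AgreesAt Y (h x) (h y) y) :
    ∃ g : X → ℤ, ∀ b, AgreesAt Y g (h b) b := by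
  have hloc : IsLocCocycle (localJump Y h) := fun x =>
    eventually_localJump_add hY ((hh x).mono fun y hy => ⟨hy, hh y⟩)
  obtain ⟨K, hK⟩ := hloc.exists_primitive hX
  exact ⟨_, fun b => agreesAt_of_isCocycleLift (hh b) (hK b)⟩

end

/-! ### General position of segments with respect to sets of small Hausdorff dimension. -/

section

open Set Filter Module

section GeneralPosition

variable {E : Type*} [NormedAddCommGroup E] [InnerProductSpace ℝ E]

theorem dense_sub_notMem_submodule {P : Submodule ℝ E} (hP : P ≠ ⊤) (x₀ : E) :
    Dense {w | w - x₀ ∉ P} := by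
  refine interior_eq_empty_iff_dense_compl.1 (?_ : interior {w | w - x₀ ∈ P} = ∅)
  by_contra! hne
  apply hP
  refine P.eq_top_of_nonempty_interior' ?_
  obtain ⟨w, hw⟩ := hne
  refine ⟨w - x₀, ?_⟩
  have : (Homeomorph.subRight x₀) ⁻¹' (P : Set E) = {w | w - x₀ ∈ P} := rfl
  rw [← this, ← Homeomorph.preimage_interior] at hw
  exact hw

/-- Move a target `w₀` outside `x₀ + P` by vectors `f` orthogonal to `P` and to `w₀ - x₀`. A point
of `S` on a segment from `K` to `w₀ + f` determines `f` through a smooth map `Ψ`, so the bad `f` lie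
in an image of `S`, of dimension too small to fill `F`. -/
theorem dense_segment_disjoint [FiniteDimensional ℝ E] {S K : Set E} {P : Submodule ℝ E} {x₀ : E}
    (hdim : dimH S + ((finrank ℝ P + 1 : ℕ) : ℝ≥0∞) < (finrank ℝ E : ℕ))
    (hK : ∀ κ ∈ K, κ - x₀ ∈ P) (hKS : ∀ κ ∈ K, κ ∉ S) :
    Dense {w | ∀ κ ∈ K, ∀ q ∈ segment ℝ κ w, q ∉ S} := by
  have hP : P ≠ ⊤ := by
    rintro rfl
    rw [finrank_top] at hdim
    have : ((finrank ℝ E + 1 : ℕ) : ℝ≥0∞) < (finrank ℝ E : ℕ) :=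
      lt_of_le_of_lt le_add_self hdim
    rw [Nat.cast_lt] at this
    omega
  rw [dense_iff_inter_open]
  intro U hU hUne
  obtain ⟨w₀, hw₀U, hw₀⟩ := (dense_sub_notMem_submodule hP x₀).inter_open_nonempty U hU hUne
  set u := w₀ - x₀ with hu
  set e : E := u - P.starProjection u with he
  have heP : e ∈ Pᗮ := P.sub_starProjection_mem_orthogonal u
  have he0 : e ≠ 0 := by
    intro h0
    apply hw₀
    have h1 : u = P.starProjection u := sub_eq_zero.1 h0
    rw [← hu, h1]
    exact P.starProjection_apply_mem u
  set c : ℝ := inner ℝ e e with hc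
  have hc0 : 0 < c := real_inner_self_pos.2 he0
  have heu : inner ℝ e u = c := by
    have : u = e + P.starProjection u := by simp [he]
    nth_rewrite 1 [this]
    rw [inner_add_right, (P.mem_orthogonal' e).1 heP _ (P.starProjection_apply_mem u), add_zero]
  have heκ : ∀ p ∈ P, inner ℝ e p = 0 := fun p hp => (P.mem_orthogonal' e).1 heP p hp
  set Q : Submodule ℝ E := P ⊔ Submodule.span ℝ {e} with hQ
  have hPQ : P ≤ Q := le_sup_left
  have heQ : e ∈ Q := Submodule.mem_sup_right (Submodule.mem_span_singleton_self e)
  have huQ : u ∈ Q := by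
    have : u = e + P.starProjection u := by simp [he]
    rw [this]
    exact Q.add_mem heQ (hPQ (P.starProjection_apply_mem u))
  set F := Qᗮ with hF
  have hdimF : dimH S < finrank ℝ F := by
    have h1 : finrank ℝ Q ≤ finrank ℝ P + 1 := by
      refine (Submodule.finrank_add_le_finrank_add_finrank _ _).trans ?_
      rw [finrank_span_singleton he0]
    have h2 : finrank ℝ Q + finrank ℝ F = finrank ℝ E := Q.finrank_add_finrank_orthogonal
    have h3 : (finrank ℝ E : ℝ≥0∞) ≤ (finrank ℝ F : ℝ≥0∞) + ((finrank ℝ P + 1 : ℕ) : ℝ≥0∞) := by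
      rw [← Nat.cast_add, Nat.cast_le]
      omega
    exact lt_of_add_lt_add_right (hdim.trans_le h3)
  set s : Set E := {q | 0 < inner ℝ e (q - x₀)} with hs
  have hsconv : Convex ℝ s := by
    have : s = {q | inner ℝ e x₀ < innerSL ℝ e q} := by
      ext q
      simp [hs, inner_sub_right]
    rw [this]
    exact convex_halfSpace_gt (innerSL ℝ e).isLinear _
  -- Rescale `q - x₀` so that its `e`-component is that of `w₀ - x₀`, then take the `F`-component.
  -- On the segment at parameter `t` this divides `t • f` by `t`.
  let Ψ : E → F := fun q => (c / inner ℝ e (q - x₀)) • F.orthogonalProjectionOnto (q - x₀)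
  have hΨ : ContDiffOn ℝ 1 Ψ s := by
    have h1 : ContDiffOn ℝ 1 (fun q : E => inner ℝ e (q - x₀)) s :=
      (contDiff_const.inner ℝ (contDiff_id.sub contDiff_const)).contDiffOn
    have h2 : ContDiffOn ℝ 1 (fun q : E => F.orthogonalProjectionOnto (q - x₀)) s :=
      (F.orthogonalProjectionOnto.contDiff.comp (contDiff_id.sub contDiff_const)).contDiffOn
    have h3 : ContDiffOn ℝ 1 (fun q : E => c / inner ℝ e (q - x₀)) s :=
      contDiffOn_const.div h1 fun q hq => ne_of_gt hq
    exact h3.smul h2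
  have hdense := hΨ.dense_compl_image_of_dimH_lt_finrank hsconv
    (inter_subset_right : S ∩ s ⊆ s) ((dimH_mono inter_subset_left).trans_lt hdimF)
  obtain ⟨f, hfU, hf⟩ := hdense.inter_open_nonempty {f : F | w₀ + f ∈ U}
    (hU.preimage (by fun_prop)) ⟨0, by simpa using hw₀U⟩
  refine ⟨w₀ + f, hfU, fun κ hκ q hq hqS => hf ?_⟩
  obtain ⟨a, t, ha, ht, hat, rfl⟩ := hq
  set q := a • κ + t • (w₀ + (f : E)) with hq
  have hqx : q - x₀ = a • (κ - x₀) + t • (u + f) := by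
    have : x₀ = (a + t) • x₀ := by rw [hat, one_smul]
    nth_rewrite 1 [this]
    rw [hq, hu]
    module
  have hef : inner ℝ e (f : E) = 0 := (Q.mem_orthogonal (f : E)).1 f.2 e heQ
  have hinner : inner ℝ e (q - x₀) = t * c := by
    rw [hqx, inner_add_right, inner_smul_right, inner_smul_right, inner_add_right, heu, hef,
      heκ _ (hK κ hκ)]
    ring
  have ht0 : 0 < t := by
    rcases ht.lt_or_eq with h | h
    · exact h
    · exfalso
      refine hKS κ hκ ?_
      have : q = κ := by
        rw [hq, ← h, show a = 1 by linarith]; simp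
      rwa [← this]
  refine ⟨q, ⟨hqS, ?_⟩, ?_⟩
  · change 0 < inner ℝ e (q - x₀)
    rw [hinner]; positivity
  · have hproj : ∀ p ∈ Q, F.orthogonalProjectionOnto p = 0 := fun p hp =>
      Q.orthogonalProjectionOnto_orthogonal_apply_eq_zero hp
    have h1 : F.orthogonalProjectionOnto (q - x₀) = t • f := by
      rw [hqx, map_add, map_smul, map_smul, map_add, hproj _ (hPQ (hK κ hκ)), hproj _ huQ]
      simp
    change (c / inner ℝ e (q - x₀)) • F.orthogonalProjectionOnto (q - x₀) = f
    rw [h1, hinner, smul_smul]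
    have : c / (t * c) * t = 1 := by field_simp
    rw [this, one_smul]

end GeneralPosition

end

/-! ### Complements of thin closed sets, and gluing across such sets. -/

section

open Set Filter Module

section GeneralPosition

variable {E : Type*} [NormedAddCommGroup E] [InnerProductSpace ℝ E]

theorem isPreconnected_of_segment_subset {U : Set E}
    (h : ∀ y ∈ U, ∀ V, IsOpen V → (U ∩ V).Nonempty → ∃ w ∈ V, segment ℝ y w ⊆ U) :
    IsPreconnected U := by
  rintro u v hu hv huv ⟨y, hyU, hyu⟩ hne
  obtain ⟨w, hwv, hw⟩ := h y hyU v hv hne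
  obtain ⟨z, hz, hz'⟩ := (convex_segment y w).isPreconnected u v hu hv (hw.trans huv)
    ⟨y, left_mem_segment ℝ y w, hyu⟩ ⟨w, right_mem_segment ℝ y w, hwv⟩
  exact ⟨z, hw hz, hz'⟩

/-- The points of `B` that are visible from `x₀` in the complement of `S`. -/
def visibleSet (B S : Set E) (x₀ : E) : Set E :=
  {y | y ∈ B ∧ ∀ q ∈ segment ℝ x₀ y, q ∉ S}

theorem visibleSet_subset {B S : Set E} {x₀ : E} : visibleSet B S x₀ ⊆ B \ S :=
  fun y hy => ⟨hy.1, hy.2 y (right_mem_segment ℝ x₀ y)⟩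

/-- The obstructed points are the projection of a closed set along the compact unit interval. -/
theorem isOpen_visibleSet {B S : Set E} (hB : IsOpen B) (hS : IsClosed S) (x₀ : E) :
    IsOpen (visibleSet B S x₀) := by
  change IsOpen (B ∩ {y | ∀ q ∈ segment ℝ x₀ y, q ∉ S})
  refine hB.inter ?_
  have h1 : IsClosed {p : unitInterval × E | x₀ + (p.1 : ℝ) • (p.2 - x₀) ∈ S} :=
    hS.preimage (by fun_prop)
  have h2 := isClosedMap_snd_of_compactSpace _ h1
  suffices h : {y | ∀ q ∈ segment ℝ x₀ y, q ∉ S} = (Prod.snd ''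
      {p : unitInterval × E | x₀ + (p.1 : ℝ) • (p.2 - x₀) ∈ S})ᶜ by
    rw [h]
    exact h2.isOpen_compl
  ext y
  simp only [mem_ofPred_eq, mem_compl_iff, mem_image, Prod.exists, exists_eq_right, segment_eq_image']
  constructor
  · rintro h ⟨t, ht⟩
    exact h _ ⟨t, t.2, rfl⟩ ht
  · rintro h _ ⟨t, ht, rfl⟩ hS
    exact h ⟨⟨t, ht⟩, hS⟩

theorem starConvex_visibleSet {B S : Set E} (hB : Convex ℝ B) {x₀ : E} (hx₀ : x₀ ∈ B) :
    StarConvex ℝ x₀ (visibleSet B S x₀) := by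
  rw [starConvex_iff_segment_subset]
  rintro y ⟨hy, hyS⟩ z hz
  exact ⟨hB.segment_subset hx₀ hy hz, fun q hq =>
    hyS q ((convex_segment x₀ y).segment_subset (left_mem_segment ℝ x₀ y) hz hq)⟩

variable [FiniteDimensional ℝ E]

theorem dense_segment_disjoint_singleton {S : Set E} (hdim : dimH S + 1 < (finrank ℝ E : ℕ))
    {x₀ : E} (hx₀ : x₀ ∉ S) : Dense {w | ∀ q ∈ segment ℝ x₀ w, q ∉ S} := by
  have := dense_segment_disjoint (S := S) (K := {x₀}) (P := ⊥) (x₀ := x₀) (by simpa using hdim)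
    (by simp) (by simpa using hx₀)
  simpa using this

theorem Convex.isPreconnected_diff_of_dimH_lt {B S : Set E} (hB : Convex ℝ B) (hBo : IsOpen B)
    (hS : IsClosed S) (hdim : dimH S + 1 < (finrank ℝ E : ℕ)) : IsPreconnected (B \ S) := by
  refine isPreconnected_of_segment_subset fun y hy V hV hne => ?_
  obtain ⟨w, ⟨⟨hwB, hwS⟩, hwV⟩, hw⟩ := (dense_segment_disjoint_singleton hdim hy.2).inter_open_nonempty
    _ ((hBo.sdiff hS).inter hV) hne
  exact ⟨w, hwV, fun q hq => ⟨hB.segment_subset hy.1 hwB hq, hw q hq⟩⟩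

/-- For a segment from `y` to `w` to remain visible, the whole triangle `x₀ y w` must miss `S`. It
is swept out by segments from `[x₀, y]` to a generic `w`; the base lies on a line, whence the 2 in
the dimension bound. -/
theorem isPreconnected_visibleSet_inter {B S B' : Set E} (hB : Convex ℝ B) (hBo : IsOpen B)
    (hS : IsClosed S) (hdim : dimH S + 2 < (finrank ℝ E : ℕ)) {x₀ : E}
    (hB' : Convex ℝ B') (hBo' : IsOpen B') : IsPreconnected (visibleSet B S x₀ ∩ B') := by
  refine isPreconnected_of_segment_subset fun y hy V hV hne => ?_
  have hP : finrank ℝ (Submodule.span ℝ {y - x₀}) ≤ 1 := by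
    simpa using finrank_span_le_card (R := ℝ) ({y - x₀} : Set E)
  have hd := dense_segment_disjoint (S := S) (K := segment ℝ x₀ y)
    (P := Submodule.span ℝ {y - x₀}) (x₀ := x₀)
    (by
      refine lt_of_le_of_lt ?_ hdim
      gcongr
      exact_mod_cast (by omega : finrank ℝ (Submodule.span ℝ {y - x₀}) + 1 ≤ 2))
    (by
      rw [segment_eq_image']
      rintro _ ⟨t, -, rfl⟩
      simpa using Submodule.smul_mem _ t (Submodule.mem_span_singleton_self (y - x₀)))
    hy.1.2
  obtain ⟨w, ⟨⟨hwG, hwB'⟩, hwV⟩, hw⟩ := hd.inter_open_nonempty _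
    (((isOpen_visibleSet hBo hS x₀).inter hBo').inter hV) hne
  refine ⟨w, hwV, fun m hm => ⟨⟨hB.segment_subset hy.1.1 hwG.1 hm, fun q hq => ?_⟩,
    hB'.segment_subset hy.2 hwB' hm⟩⟩
  have hq' : q ∈ convexJoin ℝ {x₀} (convexJoin ℝ {y} {w}) := by
    rw [convexJoin_singletons]
    exact mem_convexJoin.2 ⟨x₀, rfl, m, hm, hq⟩
  rw [← convexJoin_assoc, convexJoin_singletons] at hq'
  obtain ⟨κ, hκ, w', rfl, hqw⟩ := mem_convexJoin.1 hq'
  exact hw κ hκ q hqw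

end GeneralPosition

section Extension

variable {E : Type*} [NormedAddCommGroup E] [InnerProductSpace ℝ E] [FiniteDimensional ℝ E]
  {X : Type*} [TopologicalSpace X] {F : X → E} {S : Set E} {Y : Set X}

theorem agreesAt_of_dimH_lt (hF : IsLocalHomeomorph F) (hS : IsClosed S)
    (hdim : dimH S + 1 < (finrank ℝ E : ℕ)) (hY : Dense Y) (hYS : ∀ y ∈ Y, F y ∉ S)
    {g h : X → ℤ} {x : X} (H : ∀ᶠ y in 𝓝 x, F y ∉ S → AgreesAt Y g h y) : AgreesAt Y g h x := by
  obtain ⟨e, hx, rfl⟩ := hF x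
  have h1 : ∀ᶠ y in 𝓝 (e x), y ∈ e.target ∧ (y ∉ S → AgreesAt Y g h (e.symm y)) := by
    refine Eventually.and (e.open_target.mem_nhds (e.map_source hx)) ?_
    have h2 : ∀ᶠ y in 𝓝 (e x), e (e.symm y) ∉ S → AgreesAt Y g h (e.symm y) := by
      have := (e.continuousAt_symm (e.map_source hx)).tendsto
      rw [e.left_inv hx] at this
      exact this.eventually H
    filter_upwards [h2, e.open_target.mem_nhds (e.map_source hx)] with y h2 h3
    rwa [e.right_inv h3] at h2
  obtain ⟨r, hr, hball⟩ := Metric.eventually_nhds_iff_ball.1 h1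
  have hpre := ((convex_ball (e x) r).isPreconnected_diff_of_dimH_lt Metric.isOpen_ball hS
    hdim).image e.symm (e.continuousOn_symm.mono fun y hy => (hball y hy.1).1)
  obtain ⟨c, hc⟩ := exists_sub_eq_of_agreesAt (g := g) (h := h) hY hpre (by
    rintro _ ⟨y, hy, rfl⟩
    exact (hball y hy.1).2 hy.2)
  refine ⟨c, ?_⟩
  filter_upwards [self_mem_nhdsWithin, mem_nhdsWithin_of_mem_nhds (e.open_source.mem_nhds hx),
    mem_nhdsWithin_of_mem_nhds
      ((e.continuousAt hx).preimage_mem_nhds (Metric.ball_mem_nhds _ hr))] with z h1 h2 h3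
  exact hc z ⟨e z, ⟨h3, hYS z h1⟩, e.left_inv h2⟩ h1

/-- The visible set `G` is star-shaped, so a primitive `g₁` exists over it. `G` is dense in the ball
and meets small balls around points off `S` in connected sets, so there `g₁` differs from `h y` by a
single constant; this extends `g₁` over `B \ S`. -/
theorem exists_agreesAt_near [LocallyPathConnectedSpace X] (hF : IsLocalHomeomorph F)
    (hS : IsClosed S) (hdim : dimH S + 2 < (finrank ℝ E : ℕ)) (hY : Dense Y) {h : X → X → ℤ}
    (hh : ∀ x, F x ∉ S → ∀ᶠ y in 𝓝 x, AgreesAt Y (h x) (h y) y) (x : X) :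
    ∃ g : X → ℤ, ∀ᶠ y in 𝓝 x, F y ∉ S → AgreesAt Y g (h y) y := by
  classical
  have hdim1 : dimH S + 1 < (finrank ℝ E : ℕ) :=
    lt_of_le_of_lt (by gcongr; norm_num) hdim
  obtain ⟨e, hx, rfl⟩ := hF x
  obtain ⟨r, hr, hball⟩ := Metric.mem_nhds_iff.1 (e.open_target.mem_nhds (e.map_source hx))
  set B := Metric.ball (e x) r with hBdef
  have hBc : Convex ℝ B := convex_ball _ _
  have hBo : IsOpen B := Metric.isOpen_ball
  obtain ⟨x₀, hx₀B, hx₀S⟩ := (dense_compl_of_dimH_lt_finrank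
    (lt_of_le_of_lt le_self_add hdim)).inter_open_nonempty B hBo ⟨_, Metric.mem_ball_self hr⟩
  set G := visibleSet B S x₀ with hG
  have hGo : IsOpen G := isOpen_visibleSet hBo hS x₀
  have hGB : G ⊆ B := fun y hy => hy.1
  have hGne : G.Nonempty := ⟨x₀, hx₀B, by simpa using hx₀S⟩
  have hGt : G ⊆ e.symm.source := hGB.trans hball
  set GX := e.symm '' G with hGX
  have hGXo : IsOpen GX := e.symm.isOpen_image_of_subset_source hGo hGt
  have hGXs : SimplyConnectedSpace GX := by
    have := (starConvex_visibleSet (S := S) hBc hx₀B).contractibleSpace hGne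
    have := (e.symm.homeomorphOfImageSubsetSource hGt rfl).symm.contractibleSpace
    infer_instance
  obtain ⟨g₁, hg₁⟩ := exists_agreesAt_of_simplyConnected hY hGXo hGXs (h := h) (by
    rintro _ ⟨y, hy, rfl⟩
    refine hh _ ?_
    rw [e.right_inv (hGt hy)]
    exact (visibleSet_subset hy).2)
  set V := e.symm '' (B \ S) with hV
  have hVt : B \ S ⊆ e.symm.source := sdiff_subset.trans hball
  have hVo : IsOpen V := e.symm.isOpen_image_of_subset_source (hBo.sdiff hS) hVt
  have hVS : ∀ y ∈ V, e y ∉ S := by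
    rintro _ ⟨y, hy, rfl⟩
    rw [e.right_inv (hVt hy)]
    exact hy.2
  have hc : ∀ y ∈ V, ∃ c, ∀ᶠ z in 𝓝 y, z ∈ GX → z ∈ Y → g₁ z - h y z = c := by
    rintro _ ⟨y, hy, rfl⟩
    have hyt : y ∈ e.target := hVt hy
    have h1 : ∀ᶠ z in 𝓝 y, z ∈ B \ S ∧ AgreesAt Y (h (e.symm y)) (h (e.symm z)) (e.symm z) := by
      refine Eventually.and ((hBo.sdiff hS).mem_nhds hy) ?_
      exact (e.continuousAt_symm hyt).eventually (hh _ (hVS _ (mem_image_of_mem _ hy)))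
    obtain ⟨ρ, hρ, hball'⟩ := Metric.eventually_nhds_iff_ball.1 h1
    have hpre := (isPreconnected_visibleSet_inter hBc hBo hS hdim (convex_ball y ρ)
      Metric.isOpen_ball).image e.symm (e.continuousOn_symm.mono fun z hz => hGt hz.1)
    obtain ⟨c, hc⟩ := exists_sub_eq_of_agreesAt (g := g₁) (h := h (e.symm y)) hY hpre (by
      rintro _ ⟨z, hz, rfl⟩
      exact (hg₁ _ ⟨z, hz.1, rfl⟩).trans (hball' z hz.2).2.symm)
    refine ⟨c, ?_⟩
    have hcont : ∀ᶠ z in 𝓝 (e.symm y), e z ∈ Metric.ball y ρ := by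
      refine (e.continuousAt (e.map_target hyt)).eventually ?_
      rw [e.right_inv hyt]
      exact Metric.ball_mem_nhds y hρ
    filter_upwards [hcont] with z hz hzG hzY
    obtain ⟨z', hz', rfl⟩ := hzG
    rw [e.right_inv (hGt hz')] at hz
    exact hc _ ⟨z', ⟨hz', hz⟩, rfl⟩ hzY
  choose! c hc using hc
  have hcl : ∀ z ∈ V, (𝓝[GX ∩ Y] z).NeBot := by
    intro z hz
    rw [← mem_closure_iff_nhdsWithin_neBot]
    refine closure_minimal (hY.open_subset_closure_inter hGXo) isClosed_closure ?_
    obtain ⟨z, hz, rfl⟩ := hz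
    refine mem_closure_image (e.continuousAt_symm (hVt hz)) ?_
    have := (dense_segment_disjoint_singleton hdim1 hx₀S).open_subset_closure_inter hBo
    exact this hz.1
  -- Since `c z` is the value of `g₁ - h z` near `z` on the visible part, `c z + h z z` is the value
  -- that `g₁` ought to take at `z`.
  refine ⟨fun z => if z ∈ V then c z + h z z else 0, ?_⟩
  have hBX : ∀ᶠ y in 𝓝 x, y ∈ e.source ∧ e y ∈ B :=
    Eventually.and (e.open_source.mem_nhds hx)
      ((e.continuousAt hx).preimage_mem_nhds (Metric.ball_mem_nhds _ hr))
  filter_upwards [hBX] with y hy hyS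
  have hyV : y ∈ V := ⟨e y, ⟨hy.2, hyS⟩, e.left_inv hy.1⟩
  refine ⟨c y, ?_⟩
  filter_upwards [mem_nhdsWithin_of_mem_nhds (hVo.mem_nhds hyV),
    mem_nhdsWithin_of_mem_nhds (hh y hyS), self_mem_nhdsWithin,
    mem_nhdsWithin_of_mem_nhds (hc y hyV).eventually_nhds] with z hzV hz hzY hzc
  obtain ⟨d, hd⟩ := hz
  have hdz := hd.self_of_nhdsWithin hzY
  have := hcl z hzV
  obtain ⟨w, ⟨⟨h1, h2⟩, h3⟩, h4, h5⟩ :=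
    (((eventually_nhdsWithin_of_eventually_nhds ((hc z hzV).and hzc)).and
      (nhdsWithin_mono z inter_subset_right hd)).and self_mem_nhdsWithin).exists (f := 𝓝[GX ∩ Y] z)
  have e1 := h1 h4 h5
  have e2 := h2 h4 h5
  simp only [hzV, if_true]
  omega

/-- If the first homology of `X` vanishes, a compatible family of local functions given away from a
closed subset of codimension greater than two has a global primitive. -/
theorem exists_agreesAt_of_homology_of_dimH {X : Type u} [TopologicalSpace X]
    [PathConnectedSpace X] [LocallyPathConnectedSpace X] (hX : FirstHomologyVanishes X)
    {F : X → E} {Y : Set X} (hF : IsLocalHomeomorph F) (hS : IsClosed S)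
    (hdim : S.Nonempty → dimH S + 2 < (finrank ℝ E : ℕ)) (hY : Dense Y)
    (hYS : ∀ y ∈ Y, F y ∉ S) {h : X → X → ℤ}
    (hh : ∀ x, F x ∉ S → ∀ᶠ y in 𝓝 x, AgreesAt Y (h x) (h y) y) :
    ∃ g : X → ℤ, ∀ x, F x ∉ S → AgreesAt Y g (h x) x := by
  classical
  have hex : ∀ x, F x ∈ S → ∃ g : X → ℤ, ∀ᶠ y in 𝓝 x, F y ∉ S → AgreesAt Y g (h y) y :=
    fun x hx => exists_agreesAt_near hF hS (hdim ⟨_, hx⟩) hY hh x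
  choose! k hk using hex
  -- Over `S` the given models are replaced by the extended ones; any two agree across `S`, whose
  -- complement is locally connected.
  obtain ⟨g, hg⟩ := exists_agreesAt_of_homology hX hY
    (h := fun x => if F x ∈ S then k x else h x) (by
      intro x
      by_cases hx : F x ∈ S
      · have hdim1 : dimH S + 1 < (finrank ℝ E : ℕ) :=
          lt_of_le_of_lt (by gcongr; norm_num) (hdim ⟨_, hx⟩)
        simp only [hx, if_true]
        filter_upwards [(hk x hx).eventually_nhds] with y hy
        by_cases hyS : F y ∈ S
        · simp only [hyS, if_true]
          refine agreesAt_of_dimH_lt hF hS hdim1 hY hYS ?_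
          filter_upwards [hy, hk y hyS] with z h1 h2 hz
          exact (h1 hz).trans (h2 hz).symm
        · simp only [hyS, if_false]
          exact hy.self_of_nhds hyS
      · simp only [hx, if_false]
        filter_upwards [hh x hx, (hS.isOpen_compl.preimage hF.continuous).mem_nhds hx] with y h1 h2
        have h2' : F y ∉ S := h2
        simpa only [h2', if_false] using h1)
  refine ⟨g, fun x hx => ?_⟩
  simpa only [hx, if_false] using hg x

end Extension

end

/-! ### From an orientation of `A` to a coorientation. -/

section

open Set Filter Module

/-- Near `p` the function `f` cuts out `A` and its two sides are connected in arbitrarily small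
neighbourhoods. -/
def IsTwoSidedAt {E : Type*} [TopologicalSpace E] (A : Set E) (f : E → ℝ) (p : E) : Prop :=
  ∀ N ∈ 𝓝 p, ∃ V, IsOpen V ∧ p ∈ V ∧ V ⊆ N ∧ (∀ x ∈ V, x ∈ A ↔ f x = 0) ∧
    (IsPreconnected {x | x ∈ V ∧ 0 < f x} ∧ {x | x ∈ V ∧ 0 < f x}.Nonempty) ∧
    (IsPreconnected {x | x ∈ V ∧ f x < 0} ∧ {x | x ∈ V ∧ f x < 0}.Nonempty)

/-- A coherent choice of local defining functions of the hypersurface `A`. -/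
structure IsCoorientation {E : Type*} [TopologicalSpace E] (A : Set E) (ρ : E → E → ℝ) : Prop where
  twoSided : ∀ p ∈ A, IsTwoSidedAt A (ρ p) p
  coherent : ∀ p ∈ A, ∀ᶠ q in 𝓝 p, q ∈ A → ∀ᶠ z in 𝓝 q,
    (0 < ρ q z ↔ 0 < ρ p z) ∧ (ρ q z < 0 ↔ ρ p z < 0)

theorem IsTwoSidedAt.neg {E : Type*} [TopologicalSpace E] {A : Set E} {f : E → ℝ} {p : E}
    (h : IsTwoSidedAt A f p) : IsTwoSidedAt A (fun x => -f x) p := by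
  intro N hN
  obtain ⟨V, h1, h2, h3, h4, h5, h6⟩ := h N hN
  exact ⟨V, h1, h2, h3, by simpa using h4, by simpa using h6, by simpa using h5⟩

section Chart

variable {n : ℕ}

theorem Convex.isPreconnected_and_nonempty_ball_halfSpace (y : Eucl n) {r : ℝ} (hr : 0 < r)
    (k : Fin n) (hy : y k = 0) {ε : ℝ} (hε : ε ≠ 0) :
    IsPreconnected {x | x ∈ Metric.ball y r ∧ 0 < ε * x k} ∧
      {x | x ∈ Metric.ball y r ∧ 0 < ε * x k}.Nonempty := by
  constructor
  · refine Convex.isPreconnected ((convex_ball y r).inter ?_)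
    have := convex_halfSpace_gt (𝕜 := ℝ) (f := fun x : Eucl n => ε * x k)
      ⟨fun x z => by simp [mul_add], fun c x => by simp; ring⟩ 0
    exact this
  · refine ⟨y + (r / 2 * SignType.sign ε) • EuclideanSpace.single k 1, ?_, ?_⟩
    · rw [Metric.mem_ball, dist_eq_norm, add_sub_cancel_left, norm_smul, PiLp.norm_single,
        norm_mul]
      have h1 : ‖((SignType.sign ε : SignType) : ℝ)‖ ≤ 1 := by
        rcases lt_trichotomy ε 0 with h | h | h <;> simp [h]
      have h2 : ‖r / 2‖ = r / 2 := abs_of_pos (by positivity)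
      rw [h2, norm_one, mul_one]
      nlinarith
    · have : ε * (r / 2 * SignType.sign ε) = r / 2 * |ε| := by
        rw [← self_mul_sign ε]; ring
      simp only [PiLp.add_apply, PiLp.smul_apply, PiLp.single_apply, hy, if_true,
        smul_eq_mul, mul_one, zero_add, this]
      have := abs_pos.2 hε
      positivity

theorem OpenPartialHomeomorph.isTwoSidedAt {A : Set (Eucl n)}
    (Φ : OpenPartialHomeomorph (Eucl n) (Eucl n)) {p : Eucl n} (hp : p ∈ Φ.source) (hpA : p ∈ A)
    (k : Fin n) (hA : ∀ x ∈ Φ.source, x ∈ A ↔ Φ x k = 0) :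
    IsTwoSidedAt A (fun x => Φ x k) p := by
  intro N hN
  have hpt := Φ.map_source hp
  have h1 : ∀ᶠ y in 𝓝 (Φ p), y ∈ Φ.target ∧ Φ.symm y ∈ N := by
    refine Eventually.and (Φ.open_target.mem_nhds hpt) ((Φ.continuousAt_symm hpt).eventually ?_)
    rwa [Φ.left_inv hp]
  obtain ⟨r, hr, hball⟩ := Metric.eventually_nhds_iff_ball.1 h1
  have hsub : Metric.ball (Φ p) r ⊆ Φ.symm.source := fun y hy => (hball y hy).1
  set V := Φ.symm '' Metric.ball (Φ p) r with hV
  have hVs : V ⊆ Φ.source := by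
    rintro _ ⟨y, hy, rfl⟩
    exact Φ.map_target (hsub hy)
  have key : ∀ ε : ℝ, ε ≠ 0 → IsPreconnected {x | x ∈ V ∧ 0 < ε * Φ x k} ∧
      {x | x ∈ V ∧ 0 < ε * Φ x k}.Nonempty := by
    intro ε hε
    obtain ⟨h2, h3⟩ := Convex.isPreconnected_and_nonempty_ball_halfSpace (Φ p) hr k
      ((hA p hp).1 hpA) hε
    have himg : {x | x ∈ V ∧ 0 < ε * Φ x k} =
        Φ.symm '' {x | x ∈ Metric.ball (Φ p) r ∧ 0 < ε * x k} := by
      ext x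
      constructor
      · rintro ⟨⟨y, hy, rfl⟩, hx⟩
        rw [Φ.right_inv (hsub hy)] at hx
        exact ⟨y, ⟨hy, hx⟩, rfl⟩
      · rintro ⟨y, ⟨hy, hx⟩, rfl⟩
        refine ⟨⟨y, hy, rfl⟩, ?_⟩
        rwa [Φ.right_inv (hsub hy)]
    rw [himg]
    exact ⟨h2.image _ (Φ.continuousOn_symm.mono fun y hy => hsub hy.1), h3.image _⟩
  refine ⟨V, Φ.symm.isOpen_image_of_subset_source Metric.isOpen_ball hsub,
    ⟨Φ p, Metric.mem_ball_self hr, Φ.left_inv hp⟩, ?_, fun x hx => hA x (hVs hx), ?_, ?_⟩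
  · rintro _ ⟨y, hy, rfl⟩
    exact (hball y hy).2
  · simpa using key 1 one_ne_zero
  · simpa using key (-1) (by norm_num)

theorem IsSmoothChart.contDiffAt_coord {Φ : OpenPartialHomeomorph (Eucl n) (Eucl n)}
    (hΦ : IsSmoothChart Φ) {q : Eucl n} (hq : q ∈ Φ.source) (k : Fin n) :
    ContDiffAt ℝ 1 (fun x => Φ x k) q := by
  have h1 : ContDiffAt ℝ 1 Φ q :=
    ((hΦ.1.contDiffAt (Φ.open_source.mem_nhds hq)).of_le (by exact_mod_cast le_top))
  exact (contDiffAt_piLp 2).1 h1 k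

theorem IsSmoothChart.exists_fderiv_coord_eq_one {Φ : OpenPartialHomeomorph (Eucl n) (Eucl n)}
    (hΦ : IsSmoothChart Φ) {q : Eucl n} (hq : q ∈ Φ.source) (k : Fin n) :
    ∃ w, fderiv ℝ (fun x => Φ x k) q w = 1 := by
  have ht := Φ.map_source hq
  have h1 : DifferentiableAt ℝ (fun x => Φ x k) (Φ.symm (Φ q)) := by
    rw [Φ.left_inv hq]
    exact (hΦ.contDiffAt_coord hq k).differentiableAt one_ne_zero
  have h2 : DifferentiableAt ℝ Φ.symm (Φ q) :=
    (hΦ.2.contDiffAt (Φ.open_target.mem_nhds ht)).differentiableAt (by simp)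
  have h3 := (h1.hasFDerivAt.comp (Φ q) h2.hasFDerivAt)
  have h4 : HasFDerivAt (fun y : Eucl n => y k) (EuclideanSpace.proj k : Eucl n →L[ℝ] ℝ) (Φ q) :=
    (EuclideanSpace.proj k : Eucl n →L[ℝ] ℝ).hasFDerivAt
  have h5 : ((fun x => Φ x k) ∘ Φ.symm) =ᶠ[𝓝 (Φ q)] fun y => y k := by
    filter_upwards [Φ.open_target.mem_nhds ht] with y hy
    simp [Φ.right_inv hy]
  have h6 := h3.unique (h4.congr_of_eventuallyEq h5)
  refine ⟨fderiv ℝ Φ.symm (Φ q) (EuclideanSpace.single k 1), ?_⟩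
  have h7 := congrArg (fun L : Eucl n →L[ℝ] ℝ => L (EuclideanSpace.single k 1)) h6
  rw [Φ.left_inv hq] at h7
  simpa using h7

/-- The derivative maps the tangent cone of `A` into that of `{0} ⊆ ℝ`, which is trivial. -/
theorem tangentSubspace_le_ker {A : Set (Eucl n)} {p : Eucl n} {g : Eucl n → ℝ}
    (hg : DifferentiableAt ℝ g p) (hA : ∀ᶠ x in 𝓝 p, x ∈ A → g x = 0) :
    tangentSubspace A p ≤ (fderiv ℝ g p).ker := by
  refine Submodule.span_le.2 fun y hy => ?_
  rw [← tangentConeAt_inter_nhds (t := {x | x ∈ A → g x = 0}) hA] at hy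
  have h1 := (hg.hasFDerivAt.hasFDerivWithinAt (s := A ∩ {x | x ∈ A → g x = 0})).mapsTo_tangent_cone hy
  have h2 : g '' (A ∩ {x | x ∈ A → g x = 0}) ⊆ {0} := by
    rintro _ ⟨x, ⟨hx, hx'⟩, rfl⟩
    exact hx' hx
  have h3 : ¬ AccPt (g p) (𝓟 ({0} : Set ℝ)) := by
    intro h
    exact (Set.finite_singleton (0 : ℝ)).not_infinite (Set.Infinite.of_accPt h)
  exact tangentConeAt_subset_zero h3 (tangentConeAt_mono h2 h1)

end Chart

section SideComparison

variable {E : Type*} [NormedAddCommGroup E] [NormedSpace ℝ E]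

theorem HasFDerivAt.eventually_pos {f : E → ℝ} {L : E →L[ℝ] ℝ} {q w : E} (hf : HasFDerivAt f L q)
    (hq : f q = 0) (hw : 0 < L w) : ∀ᶠ t : ℝ in 𝓝[>] 0, 0 < f (q + t • w) := by
  have h1 : HasDerivAt (fun t : ℝ => f (q + t • w)) (L w) 0 := hf.hasLineDerivAt w
  have h2 := h1.tendsto_slope_zero_right.eventually (lt_mem_nhds hw)
  filter_upwards [h2, self_mem_nhdsWithin] with t ht ht0
  have ht0' : 0 < t := ht0
  simp only [zero_add, zero_smul, add_zero, hq, sub_zero, smul_eq_mul] at ht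
  exact (pos_iff_pos_of_mul_pos ht).1 (inv_pos.2 ht0')

/-- Both functions are positive at `q + t • w` for small `t > 0`, and `g` has no zero on the
connected positive side of `f`. -/
theorem pos_of_pos_of_hasFDerivAt {f g : E → ℝ} {L M : E →L[ℝ] ℝ} {q w : E} {V : Set E}
    (hV : V ∈ 𝓝 q) (hpre : IsPreconnected {x | x ∈ V ∧ 0 < f x}) (hg : ContinuousOn g V)
    (hfg : ∀ x ∈ V, g x = 0 → f x = 0) (hf' : HasFDerivAt f L q) (hg' : HasFDerivAt g M q)
    (hfq : f q = 0) (hgq : g q = 0) (hL : 0 < L w) (hM : 0 < M w) :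
    ∀ x ∈ V, 0 < f x → 0 < g x := by
  have hVt : ∀ᶠ t : ℝ in 𝓝[>] 0, q + t • w ∈ V := by
    refine mem_nhdsWithin_of_mem_nhds ?_
    have : ContinuousAt (fun t : ℝ => q + t • w) 0 := by fun_prop
    exact this.preimage_mem_nhds (by simpa using hV)
  obtain ⟨t, h1, h2, h3⟩ :=
    (hVt.and ((hf'.eventually_pos hfq hL).and (hg'.eventually_pos hgq hM))).exists
  intro x hx hfx
  by_contra hgx
  have hi := hpre.image g (hg.mono fun x hx => hx.1)
  have : (0 : ℝ) ∈ g '' {x | x ∈ V ∧ 0 < f x} :=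
    hi.ordConnected.out ⟨x, ⟨hx, hfx⟩, rfl⟩ ⟨_, ⟨h1, h2⟩, rfl⟩ ⟨not_lt.1 hgx, h3.le⟩
  obtain ⟨z, ⟨hz, hz'⟩, hgz⟩ := this
  exact hz'.ne' (hfg z hz hgz)

theorem IsTwoSidedAt.eventually_sides_iff {A : Set E} {f g : E → ℝ} {L M : E →L[ℝ] ℝ} {q w : E}
    (h : IsTwoSidedAt A f q) (hq : q ∈ A) (hg : ∀ᶠ x in 𝓝 q, ContinuousAt g x)
    (hgA : ∀ᶠ x in 𝓝 q, x ∈ A ↔ g x = 0) (hf' : HasFDerivAt f L q) (hg' : HasFDerivAt g M q)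
    (hL : 0 < L w) (hM : 0 < M w) :
    ∀ᶠ z in 𝓝 q, (0 < f z ↔ 0 < g z) ∧ (f z < 0 ↔ g z < 0) := by
  obtain ⟨V, hVo, hqV, hVN, hVA, ⟨hpos, -⟩, ⟨hneg, -⟩⟩ := h _ (hg.and hgA)
  have hzero : ∀ x ∈ V, f x = 0 ↔ g x = 0 := fun x hx => (hVA x hx).symm.trans (hVN hx).2
  have hgV : ContinuousOn g V := fun x hx => (hVN hx).1.continuousWithinAt
  have hfq : f q = 0 := (hVA q hqV).1 hq
  have h1 := pos_of_pos_of_hasFDerivAt (hVo.mem_nhds hqV) hpos hgV (fun x hx => (hzero x hx).2)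
    hf' hg' hfq ((hzero q hqV).1 hfq) hL hM
  have h2 := pos_of_pos_of_hasFDerivAt (f := fun x => -f x) (g := fun x => -g x) (w := -w)
    (hVo.mem_nhds hqV) (by simpa using hneg) hgV.neg
    (fun x hx h => by simpa using (hzero x hx).2 (by simpa using h))
    hf'.neg hg'.neg (by simpa using hfq) (by simpa using (hzero q hqV).1 hfq)
    (by simpa using hL) (by simpa using hM)
  simp only [Left.neg_pos_iff] at h2
  filter_upwards [hVo.mem_nhds hqV] with z hz
  have e1 := h1 z hz
  have e2 := h2 z hz
  have e3 := hzero z hz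
  refine ⟨⟨e1, fun h => ?_⟩, ⟨e2, fun h => ?_⟩⟩
  · rcases lt_trichotomy (f z) 0 with h' | h' | h'
    · exact absurd h (e2 h').not_gt
    · exact absurd (e3.1 h') h.ne'
    · exact h'
  · rcases lt_trichotomy (f z) 0 with h' | h' | h'
    · exact h'
    · exact absurd (e3.1 h') h.ne
    · exact absurd h (e1 h').not_gt

end SideComparison

section Orientation

variable {m : ℕ}

/-- The determinant of `w` followed by the vectors `v 0, …, v (m-1)`. -/
noncomputable def consDet (w : Eucl (m + 1)) (v : Fin m → Eucl (m + 1)) : ℝ :=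
  (EuclideanSpace.basisFun (Fin (m + 1)) ℝ).toBasis.det.curryLeft w v

theorem continuousAt_consDet {α : Type*} [TopologicalSpace α] (w : Eucl (m + 1))
    {v : Fin m → α → Eucl (m + 1)} {a : α} (hv : ∀ j, ContinuousAt (v j) a) :
    ContinuousAt (fun x => consDet w fun j => v j x) a := by
  have : ∀ i j, ContinuousAt (fun x => ((EuclideanSpace.basisFun (Fin (m + 1)) ℝ).toBasis.toMatrix
      (Matrix.vecCons w fun j => v j x)) i j) a := by
    intro i j
    refine Fin.cases ?_ (fun j => ?_) j
    · simp [Basis.toMatrix_apply, continuousAt_const]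
    · have := (EuclideanSpace.proj i : Eucl (m + 1) →L[ℝ] ℝ).continuous.continuousAt.comp (hv j)
      simpa [Basis.toMatrix_apply, Function.comp_def] using this
  have h2 : ContinuousAt (fun x => (EuclideanSpace.basisFun (Fin (m + 1)) ℝ).toBasis.toMatrix
      (Matrix.vecCons w fun j => v j x)) a :=
    continuousAt_pi.2 fun i => continuousAt_pi.2 fun j => this i j
  exact (continuous_id.matrix_det.continuousAt.comp h2 :)

variable {T : Submodule ℝ (Eucl (m + 1))}

theorem consDet_eq_mul_det (w : Eucl (m + 1)) (b b' : Basis (Fin m) ℝ T) :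
    (consDet w fun j => (b' j : Eucl (m + 1))) = (consDet w fun j => (b j : Eucl (m + 1))) * b.det b' := by
  have := ((((EuclideanSpace.basisFun (Fin (m + 1)) ℝ).toBasis.det.curryLeft w).compLinearMap
    T.subtype).eq_smul_basis_det b)
  exact congrArg (fun f => f b') this

theorem consDet_pos_of_orientation_eq {w : Eucl (m + 1)} {b b' : Basis (Fin m) ℝ T}
    (h : b.orientation = b'.orientation) (hb : 0 < consDet w fun j => (b j : Eucl (m + 1))) :
    0 < consDet w fun j => (b' j : Eucl (m + 1)) := by
  rw [consDet_eq_mul_det w b b']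
  exact mul_pos hb ((b.orientation_eq_iff_det_pos b').1 h)

theorem span_range_coe_basis (b : Basis (Fin m) ℝ T) :
    Submodule.span ℝ (range fun j => (b j : Eucl (m + 1))) = T := by
  have : (range fun j => (b j : Eucl (m + 1))) = T.subtype '' range b := by
    rw [← range_comp]; rfl
  rw [this, ← Submodule.map_span, b.span_eq, Submodule.map_subtype_top]

theorem linearIndependent_cons_basis_iff (b : Basis (Fin m) ℝ T) (w : Eucl (m + 1)) :
    LinearIndependent ℝ (Matrix.vecCons w fun j => (b j : Eucl (m + 1))) ↔ w ∉ T := by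
  rw [Matrix.vecCons, linearIndependent_finCons, span_range_coe_basis b]
  exact and_iff_right (b.linearIndependent.map' T.subtype T.ker_subtype)

/-- The basis forces `dim T = m`, so `T = ker L`; thus `w - L w • w₀` lies in `T` and has
determinant zero with `b`. -/
theorem consDet_eq_mul {L : Eucl (m + 1) →L[ℝ] ℝ} (hT : T ≤ L.ker) (b : Basis (Fin m) ℝ T)
    {w₀ : Eucl (m + 1)} (hw₀ : L w₀ = 1) (w : Eucl (m + 1)) :
    (consDet w fun j => (b j : Eucl (m + 1))) = L w * consDet w₀ fun j => (b j : Eucl (m + 1)) := by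
  have hTL : T = L.ker := by
    refine Submodule.eq_of_le_of_finrank_eq hT ?_
    have h1 : finrank ℝ T = m := by simp [finrank_eq_card_basis b]
    have h2 := (L : Eucl (m + 1) →ₗ[ℝ] ℝ).finrank_range_add_finrank_ker
    have h3 : (L : Eucl (m + 1) →ₗ[ℝ] ℝ).range = ⊤ := by
      rw [LinearMap.range_eq_top]
      exact fun c => ⟨c • w₀, by simp [hw₀]⟩
    rw [h3, finrank_top, finrank_self, finrank_euclideanSpace, Fintype.card_fin] at h2
    rw [h1]
    change m = finrank ℝ (L : Eucl (m + 1) →ₗ[ℝ] ℝ).ker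
    omega
  have hmem : w - L w • w₀ ∈ T := by
    rw [hTL]
    simp [hw₀]
  have h0 : (consDet (w - L w • w₀) fun j => (b j : Eucl (m + 1))) = 0 :=
    (EuclideanSpace.basisFun (Fin (m + 1)) ℝ).toBasis.det.map_linearDependent (Matrix.vecCons (w - L w • w₀) fun j => (b j : Eucl (m + 1)))
      (fun h => (linearIndependent_cons_basis_iff b _).1 h hmem)
  rw [consDet, map_sub, map_smul] at h0
  exact sub_eq_zero.1 h0

theorem consDet_ne_zero (b : Basis (Fin m) ℝ T) {w : Eucl (m + 1)} (hw : w ∉ T) :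
    (consDet w fun j => (b j : Eucl (m + 1))) ≠ 0 := by
  have hli := (linearIndependent_cons_basis_iff b w).2 hw
  have hspan := hli.span_eq_top_of_card_eq_finrank' (by simp)
  exact ((Module.Basis.is_basis_iff_det (EuclideanSpace.basisFun (Fin (m + 1)) ℝ).toBasis).1 ⟨hli, hspan⟩).ne_zero

/-- The sign of the chart coordinate is chosen so that a vector pointing to the positive side,
followed by a positive tangent basis, has positive determinant. For coherence, `w p` keeps positive
determinant with the continuous frame at nearby `q`, so both `g p` and `g q` increase along it at
`q`. -/
theorem exists_isCoorientation_succ {A : Set (Eucl (m + 1))} (hA : IsSubmanifoldOfCodim 1 A)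
    (hAo : IsOrientableSubmanifold m A) : ∃ ρ, IsCoorientation A ρ := by
  obtain ⟨o, ho⟩ := hAo
  have hdata : ∀ p : A, ∃ g : Eucl (m + 1) → ℝ, IsTwoSidedAt A g p ∧
      (∀ᶠ q in 𝓝 (p : Eucl (m + 1)), ContDiffAt ℝ 1 g q) ∧
      ∃ w, fderiv ℝ g p w = 1 ∧ ∀ b : Basis (Fin m) ℝ (tangentSubspace A (p : Eucl (m + 1))),
        b.orientation = o p → 0 < consDet w fun j => (b j : Eucl (m + 1)) := by
    intro p
    obtain ⟨Φ, hΦ, hp, ι, hι⟩ := hA p p.2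
    set k := ι 0
    have hk : ∀ x ∈ Φ.source, x ∈ A ↔ Φ x k = 0 := fun x hx => by
      rw [hι x hx, Fin.forall_fin_one]
    have hts := Φ.isTwoSidedAt hp p.2 k hk
    have hsm : ∀ᶠ q in 𝓝 (p : Eucl (m + 1)), ContDiffAt ℝ 1 (fun x => Φ x k) q := by
      filter_upwards [Φ.open_source.mem_nhds hp] with q hq
      exact hΦ.contDiffAt_coord hq k
    obtain ⟨w, hw⟩ := hΦ.exists_fderiv_coord_eq_one hp k
    have hle : tangentSubspace A (p : Eucl (m + 1)) ≤ (fderiv ℝ (fun x => Φ x k) p).ker := by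
      refine tangentSubspace_le_ker (hsm.self_of_nhds.differentiableAt one_ne_zero) ?_
      filter_upwards [Φ.open_source.mem_nhds hp] with x hx
      exact (hk x hx).1
    have hwT : w ∉ tangentSubspace A (p : Eucl (m + 1)) := fun h => by
      have h0 : fderiv ℝ (fun x => Φ x k) p w = 0 := hle h
      rw [hw] at h0
      exact one_ne_zero h0
    obtain ⟨U, hU, v, -, hb⟩ := ho p
    obtain ⟨b₀, -, hb₀⟩ := hb p (mem_of_mem_nhds hU)
    rcases lt_or_gt_of_ne (consDet_ne_zero b₀ hwT) with hneg | hpos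
    · refine ⟨fun x => -Φ x k, hts.neg, hsm.mono fun q hq => hq.neg, -w, ?_, fun b hbo => ?_⟩
      · have : fderiv ℝ (fun x => -Φ x k) p = -fderiv ℝ (fun x => Φ x k) p := fderiv_fun_neg
        rw [this]
        simpa using hw
      · refine consDet_pos_of_orientation_eq (hb₀.trans hbo.symm) ?_
        have : (consDet (-w) fun j => (b₀ j : Eucl (m + 1)))
            = -consDet w fun j => (b₀ j : Eucl (m + 1)) := by
          rw [consDet, map_neg]; rfl
        rw [this]
        linarith
    · exact ⟨fun x => Φ x k, hts, hsm, w, hw, fun b hbo =>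
        consDet_pos_of_orientation_eq (hb₀.trans hbo.symm) hpos⟩
  choose g hts hsm w hw hpos using hdata
  classical
  refine ⟨fun p => if h : p ∈ A then g ⟨p, h⟩ else 0, ?_, ?_⟩
  · intro p hp
    simpa only [dif_pos hp] using hts ⟨p, hp⟩
  · intro p hp
    obtain ⟨U, hU, v, hv, hb⟩ := ho ⟨p, hp⟩
    have hzero : ∀ q : A, ∀ᶠ x in 𝓝 (q : Eucl (m + 1)), x ∈ A ↔ g q x = 0 := by
      intro q
      obtain ⟨V, hVo, hqV, -, hVA, -⟩ := hts q univ univ_mem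
      filter_upwards [hVo.mem_nhds hqV] with x hx using hVA x hx
    set p' : A := ⟨p, hp⟩ with hp'
    have h1 : ∀ᶠ q in 𝓝 p, 0 < fderiv ℝ (g p') q (w p') := by
      have hc : ContinuousAt (fun q => fderiv ℝ (g p') q (w p')) p := by
        have := ((hsm p').self_of_nhds.fderiv_right (m := 0) (by norm_num)).continuousAt
        exact this.clm_apply continuousAt_const
      refine hc.eventually (lt_mem_nhds ?_)
      change 0 < fderiv ℝ (g p') p' (w p')
      rw [hw]
      exact one_pos
    have h2 : ∀ᶠ q in 𝓝 p', q ∈ U ∧ 0 < consDet (w p') fun j => v j q := by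
      refine Eventually.and hU ?_
      refine (continuousAt_consDet (w p') fun j =>
        (hv j).continuousAt hU).eventually (lt_mem_nhds ?_)
      obtain ⟨b, hbv, hbo⟩ := hb p' (mem_of_mem_nhds hU)
      have := hpos p' b hbo
      simpa only [hbv] using this
    rw [nhds_subtype_eq_comap, eventually_comap] at h2
    filter_upwards [h1, h2, (hsm p').eventually_nhds, (hzero p').eventually_nhds]
      with q e1 e2 e3 e4 hq
    set q' : A := ⟨q, hq⟩ with hq'
    obtain ⟨hqU, e2⟩ := e2 q' rfl
    obtain ⟨b, hbv, hbo⟩ := hb q' hqU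
    have hle : tangentSubspace A (q' : Eucl (m + 1)) ≤ (fderiv ℝ (g q') q').ker :=
      tangentSubspace_le_ker ((hsm q').self_of_nhds.differentiableAt one_ne_zero)
        ((hzero q').mono fun x hx => hx.1)
    have e5 := consDet_eq_mul hle b (hw q') (w p')
    simp only [← hbv] at e2
    rw [e5] at e2
    have e6 : 0 < fderiv ℝ (g q') q (w p') := (pos_iff_pos_of_mul_pos e2).2 (hpos q' b hbo)
    have := (hts q').eventually_sides_iff hq (e3.mono fun x hx => hx.continuousAt) e4
      ((hsm q').self_of_nhds.differentiableAt one_ne_zero).hasFDerivAt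
      (e3.self_of_nhds.differentiableAt one_ne_zero).hasFDerivAt e6 e1
    simpa only [dif_pos hp, dif_pos hq] using this

end Orientation

theorem exists_isCoorientation {n : ℕ} {A : Set (Eucl n)} (hA : IsSubmanifoldOfCodim 1 A)
    (hAo : IsOrientableSubmanifold (n - 1) A) : ∃ ρ, IsCoorientation A ρ := by
  cases n with
  | succ m => exact exists_isCoorientation_succ hA hAo
  | zero =>
    -- In dimension zero no coordinate is available for a hypersurface chart, so `A` is empty.
    have : ∀ p, p ∉ A := fun p hp => by
      obtain ⟨-, -, -, ι, -⟩ := hA p hp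
      exact (ι 0).elim0
    exact ⟨0, fun p hp => absurd hp (this p), fun p hp => absurd hp (this p)⟩

end

/-! ### Sheets over a simply connected open set and their labels along `A`. -/

section

open Set Filter Module

theorem IsPreconnected.eq_of_eventually_eq {X α : Type*} [TopologicalSpace X] {s : Set X}
    (hs : IsPreconnected s) {f : X → α} (hf : ∀ z ∈ s, ∀ᶠ w in 𝓝 z, f w = f z) {x y : X}
    (hx : x ∈ s) (hy : y ∈ s) : f x = f y := by
  have : PreconnectedSpace s := isPreconnected_iff_preconnectedSpace.1 hs
  have hloc : IsLocallyConstant fun z : s => f z := by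
    rw [IsLocallyConstant.iff_eventually_eq]
    exact fun z => continuousAt_subtype_val.eventually (hf z z.2)
  exact hloc.apply_eq_of_preconnectedSpace ⟨x, hx⟩ ⟨y, hy⟩

section Sheets

variable {E X : Type*} [TopologicalSpace E] [TopologicalSpace X]

/-- `l` labels the points of `X` over `C` by the sheets of `F` over `C`, a sheet being named by its
point over `b`. -/
structure IsSheetLabel (F : X → E) (C : Set E) (b : E) (l : X → X) : Prop where
  eventually_eq : ∀ z, F z ∈ C → ∀ᶠ w in 𝓝 z, l w = l z
  bijOn : ∀ y ∈ C, BijOn l (F ⁻¹' {y}) (F ⁻¹' {b})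
  apply_self : ∀ z, F z = b → l z = z
  const : ∀ H : X → ℤ, (∀ z, F z ∈ C → ∀ᶠ w in 𝓝 z, H w = H z) →
    ∀ z w, F z ∈ C → F w ∈ C → l z = l w → H z = H w

theorem IsCoveringMap.exists_section_of_simplyConnected {F : X → E} {D C : Set E}
    (hcov : IsCoveringMap (Dᶜ.restrictPreimage F)) (hCD : C ⊆ Dᶜ) [SimplyConnectedSpace C]
    [LocallyPathConnectedSpace C] {x : X} (hx : F x ∈ C) :
    ∃ s : E → X, ContinuousOn s C ∧ (∀ y ∈ C, F (s y) = y) ∧ s (F x) = x := by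
  classical
  let f : C(C, (Dᶜ : Set E)) := ⟨inclusion hCD, continuous_inclusion hCD⟩
  obtain ⟨σ, ⟨hσ, hσ'⟩, -⟩ := hcov.existsUnique_continuousMap_lifts f ⟨F x, hx⟩
    (⟨x, hCD hx⟩ : F ⁻¹' Dᶜ) rfl
  refine ⟨fun y => if h : y ∈ C then σ ⟨y, h⟩ else x, ?_, ?_, ?_⟩
  · rw [continuousOn_iff_continuous_domRestrict]
    have : C.domRestrict (fun y => if h : y ∈ C then ((σ ⟨y, h⟩ : F ⁻¹' Dᶜ) : X) else x)
        = fun y => ((σ y : F ⁻¹' Dᶜ) : X) := by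
      ext y
      simp
    rw [this]
    fun_prop
  · intro y hy
    simp only [dif_pos hy]
    exact congrArg Subtype.val (congrFun hσ' ⟨y, hy⟩)
  · simp only [dif_pos hx]
    rw [hσ]

/-- The label of `z` is the value at `b` of the section through `z`; sections over the connected set
`C` that meet once coincide. -/
theorem exists_isSheetLabel [T2Space X] {F : X → E} (hF : IsLocalHomeomorph F) {D C : Set E}
    (hcov : IsCoveringMap (Dᶜ.restrictPreimage F)) (hCD : C ⊆ Dᶜ) (hCo : IsOpen C)
    [SimplyConnectedSpace C] [LocallyPathConnectedSpace C] {b : E} (hb : b ∈ C) :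
    ∃ l, IsSheetLabel F C b l := by
  classical
  have hC : IsPreconnected C := isPreconnected_iff_preconnectedSpace.2 inferInstance
  have hex : ∀ x, ∃ s : E → X, F x ∈ C →
      ContinuousOn s C ∧ (∀ y ∈ C, F (s y) = y) ∧ s (F x) = x := by
    intro x
    by_cases hx : F x ∈ C
    · obtain ⟨s, hs⟩ := hcov.exists_section_of_simplyConnected hCD hx
      exact ⟨s, fun _ => hs⟩
    · exact ⟨fun _ => x, fun h => absurd h hx⟩
  choose s hs' using hex
  have hs := fun x hx => (hs' x hx).1
  have hsF := fun x hx => (hs' x hx).2.1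
  have hsx := fun x hx => (hs' x hx).2.2
  have huniq : ∀ x x', F x ∈ C → F x' ∈ C → (∃ y ∈ C, s x y = s x' y) → EqOn (s x) (s x') C := by
    rintro x x' hx hx' ⟨y, hy, h⟩
    exact (T2Space.isSeparatedMap F).eqOn_of_comp_eqOn hF.isLocallyInjective hC (hs x hx)
      (hs x' hx') (fun z hz => (hsF x hx z hz).trans (hsF x' hx' z hz).symm) hy h
  have hnear : ∀ z, F z ∈ C → ∀ᶠ w in 𝓝 z, F w ∈ C ∧ s z (F w) = w := by
    intro z hz
    obtain ⟨e, hze, rfl⟩ := hF z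
    have h1 : ∀ᶠ w in 𝓝 z, e w ∈ C := (e.continuousAt hze).eventually (hCo.mem_nhds hz)
    have h2 : ContinuousAt (fun w => s z (e w)) z :=
      ContinuousAt.comp (f := e) ((hs z hz).continuousAt (hCo.mem_nhds hz)) (e.continuousAt hze)
    have h3 : ∀ᶠ w in 𝓝 z, s z (e w) ∈ e.source := by
      refine h2.eventually (e.open_source.mem_nhds ?_)
      change s z (e z) ∈ e.source
      rwa [hsx z hz]
    filter_upwards [h1, h3, e.open_source.mem_nhds hze] with w e1 e2 e3
    exact ⟨e1, e.injOn e2 e3 (hsF z hz _ e1)⟩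
  refine ⟨fun z => s z b, ⟨fun z hz => ?_, fun y hy => ⟨fun z hz => ?_, ?_, ?_⟩, ?_, ?_⟩⟩
  · filter_upwards [hnear z hz] with w hw
    exact huniq w z hw.1 hz ⟨F w, hw.1, by rw [hw.2, hsx w hw.1]⟩ hb
  · obtain rfl : F z = y := hz
    exact hsF z hy b hb
  · rintro z hz w hw h
    obtain rfl : F z = y := hz
    have hw' : F w = F z := hw
    have := huniq z w hy (hw' ▸ hy) ⟨b, hb, h⟩ hy
    rw [hsx z hy, ← hw', hsx w (hw' ▸ hy)] at this
    exact this
  · rintro c rfl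
    have hFy : F (s c y) = y := hsF c hb y hy
    refine ⟨s c y, hFy, ?_⟩
    have hy' : F (s c y) ∈ C := by rwa [hFy]
    have h1 := hsx (s c y) hy'
    rw [hFy] at h1
    have := huniq (s c y) c hy' hb ⟨y, hy, h1⟩ hb
    exact this.trans (hsx c hb)
  · rintro z rfl
    exact hsx z hb
  · intro H hH z w hz hw h
    have h1 := huniq z w hz hw ⟨b, hb, h⟩
    have h2 : ∀ y ∈ C, ∀ᶠ y' in 𝓝 y, H (s z y') = H (s z y) := by
      intro y hy
      refine ((hs z hz).continuousAt (hCo.mem_nhds hy)).eventually (hH _ ?_)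
      rwa [hsF z hz y hy]
    have h3 := hC.eq_of_eventually_eq (f := fun y => H (s z y)) h2 hz hw
    rw [hsx z hz, h1 hw, hsx w hw] at h3
    exact h3

/-- The labels of the sheets on the two sides of a cooriented hypersurface. -/
theorem IsSheetLabel.exists_side_labels {F : X → E} (hF : IsLocalHomeomorph F) {C A : Set E} {b : E}
    {l : X → X} (hl : IsSheetLabel F C b l) {ρ : E → E → ℝ} (hρ : IsCoorientation A ρ)
    (hAC : ∀ p ∈ A, ∀ᶠ q in 𝓝 p, q ∉ A → q ∈ C) :
    ∃ lp lm : X → X, ∀ x, F x ∈ A → ∀ᶠ z in 𝓝 x,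
      (0 < ρ (F x) (F z) → F z ∈ C ∧ l z = lp x) ∧ (ρ (F x) (F z) < 0 → F z ∈ C ∧ l z = lm x) := by
  have key : ∀ x, F x ∈ A → ∃ cp cm : X, ∀ᶠ z in 𝓝 x,
      (0 < ρ (F x) (F z) → F z ∈ C ∧ l z = cp) ∧ (ρ (F x) (F z) < 0 → F z ∈ C ∧ l z = cm) := by
    intro x hx
    obtain ⟨e, hxe, rfl⟩ := hF x
    obtain ⟨V, hVo, hxV, hVN, hVA, ⟨hp, p₀, hp₀⟩, ⟨hm, m₀, hm₀⟩⟩ := hρ.twoSided _ hx _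
      (inter_mem (hAC _ hx) (e.open_target.mem_nhds (e.map_source hxe)))
    have hside : ∀ W : Set E, W ⊆ V → (∀ q ∈ W, q ∉ A) → IsPreconnected W → ∀ p ∈ W,
        ∀ z ∈ e.source, e z ∈ W → e z ∈ C ∧ l z = l (e.symm p) := by
      intro W hWV hWA hW p hp z hz hzW
      have hWt : W ⊆ e.target := fun q hq => (hVN (hWV hq)).2
      have hWC : W ⊆ C := fun q hq => (hVN (hWV hq)).1 (hWA q hq)
      refine ⟨hWC hzW, (hW.image _ (e.continuousOn_symm.mono hWt)).eq_of_eventually_eq (f := l) ?_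
        ⟨e z, hzW, e.left_inv hz⟩ ⟨p, hp, rfl⟩⟩
      rintro _ ⟨q, hq, rfl⟩
      refine hl.eventually_eq _ ?_
      rw [e.right_inv (hWt hq)]
      exact hWC hq
    refine ⟨l (e.symm p₀), l (e.symm m₀), ?_⟩
    filter_upwards [e.open_source.mem_nhds hxe,
      (e.continuousAt hxe).preimage_mem_nhds (hVo.mem_nhds hxV)] with z hz hzV
    exact ⟨fun h => hside _ (fun q hq => hq.1) (fun q hq hqA => hq.2.ne' ((hVA q hq.1).1 hqA)) hp _
        hp₀ z hz ⟨hzV, h⟩,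
      fun h => hside _ (fun q hq => hq.1) (fun q hq hqA => hq.2.ne ((hVA q hq.1).1 hqA)) hm _
        hm₀ z hz ⟨hzV, h⟩⟩
  choose! lp lm h using key
  exact ⟨lp, lm, h⟩

theorem IsTwoSidedAt.frequently {A : Set E} {f : E → ℝ} {p : E} (h : IsTwoSidedAt A f p) :
    (∃ᶠ z in 𝓝 p, 0 < f z) ∧ ∃ᶠ z in 𝓝 p, f z < 0 := by
  constructor <;>
  · rw [frequently_iff]
    intro U hU
    obtain ⟨V, -, -, hVU, -, ⟨-, z, hz⟩, ⟨-, w, hw⟩⟩ := h U hU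
    first | exact ⟨z, hVU hz.1, hz.2⟩ | exact ⟨w, hVU hw.1, hw.2⟩

theorem IsLocalHomeomorph.frequently_comp {F : X → E} (hF : IsLocalHomeomorph F) {x : X}
    {P : E → Prop} (h : ∃ᶠ y in 𝓝 (F x), P y) : ∃ᶠ z in 𝓝 x, P (F z) := by
  rw [← hF.map_nhds_eq x] at h
  exact h

section SideLabels

variable {F : X → E} {C A : Set E} {b : E} {l lp lm : X → X} {ρ : E → E → ℝ}

/-- By coherence, points close to `y` on one of its sides lie on the same side for `x`, so one such
point reads off both labels. -/
theorem side_labels_eventually_eq (hF : IsLocalHomeomorph F)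
    (hρ : IsCoorientation A ρ)
    (hlpm : ∀ x, F x ∈ A → ∀ᶠ z in 𝓝 x,
      (0 < ρ (F x) (F z) → F z ∈ C ∧ l z = lp x) ∧ (ρ (F x) (F z) < 0 → F z ∈ C ∧ l z = lm x))
    {x : X} (hx : F x ∈ A) : ∀ᶠ y in 𝓝 x, F y ∈ A → lp y = lp x ∧ lm y = lm x := by
  filter_upwards [(hlpm x hx).eventually_nhds,
    hF.continuous.continuousAt.eventually (hρ.coherent _ hx)] with y h1 h2 hy
  have h3 := (h1.and (hlpm y hy)).and (hF.continuous.continuousAt.eventually (h2 hy))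
  obtain ⟨hp, hm⟩ := (hρ.twoSided _ hy).frequently
  constructor
  · obtain ⟨z, hz, ⟨e1, e2⟩, e3⟩ := ((hF.frequently_comp hp).and_eventually h3).exists
    exact (e2.1 hz).2.symm.trans (e1.1 (e3.1.1 hz)).2
  · obtain ⟨z, hz, ⟨e1, e2⟩, e3⟩ := ((hF.frequently_comp hm).and_eventually h3).exists
    exact (e2.2 hz).2.symm.trans (e1.2 (e3.2.1 hz)).2

theorem side_labels_eq_of_eventually_const (hF : IsLocalHomeomorph F)
    (hρ : IsCoorientation A ρ)
    (hlpm : ∀ x, F x ∈ A → ∀ᶠ z in 𝓝 x,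
      (0 < ρ (F x) (F z) → F z ∈ C ∧ l z = lp x) ∧ (ρ (F x) (F z) < 0 → F z ∈ C ∧ l z = lm x))
    {x : X} {c : X} (hx : ∀ᶠ z in 𝓝 x, F z ∈ C → l z = c) :
    ∀ᶠ y in 𝓝 x, F y ∈ A → lp y = lm y := by
  filter_upwards [hx.eventually_nhds] with y h1 hy
  have h3 := h1.and (hlpm y hy)
  obtain ⟨hp, hm⟩ := (hρ.twoSided _ hy).frequently
  obtain ⟨z, hz, e1, e2⟩ := ((hF.frequently_comp hp).and_eventually h3).exists
  obtain ⟨w, hw, e3, e4⟩ := ((hF.frequently_comp hm).and_eventually h3).exists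
  rw [← (e2.1 hz).2, ← (e4.2 hw).2, e1 (e2.1 hz).1, e3 (e4.2 hw).1]

end SideLabels

/-- Local inverses carry the finite fibre to nearby ones: disjoint neighbourhoods give injectivity,
equal cardinality gives surjectivity. -/
theorem IsLocalHomeomorph.eventually_exists_bijOn_fiber [T2Space X] {F : X → E}
    (hF : IsLocalHomeomorph F) {a : E} (hfin : (F ⁻¹' {a}).Finite) {P : X → X → Prop}
    (hP : ∀ x ∈ F ⁻¹' {a}, ∀ᶠ z in 𝓝 x, P x z) :
    ∀ᶠ y in 𝓝 a, (F ⁻¹' {y}).encard = (F ⁻¹' {a}).encard →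
      ∃ ψ : X → X, BijOn ψ (F ⁻¹' {a}) (F ⁻¹' {y}) ∧ ∀ x ∈ F ⁻¹' {a}, P x (ψ x) := by
  obtain ⟨U, hU, hdisj⟩ := hfin.t2_separation
  choose e he using hF
  have h1 : ∀ᶠ y in 𝓝 a, ∀ x ∈ F ⁻¹' {a}, F ((e x).symm y) = y ∧ P x ((e x).symm y) ∧
      (e x).symm y ∈ U x := by
    rw [eventually_all_finite hfin]
    intro x hx
    have hax : e x x = a := (congrFun (he x).2 x).symm.trans hx
    have hat : a ∈ (e x).target := hax ▸ (e x).map_source (he x).1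
    have hc := ((e x).continuousAt_symm hat).tendsto
    have hsx : (e x).symm a = x := by rw [← hax, (e x).left_inv (he x).1]
    rw [hsx] at hc
    filter_upwards [(e x).open_target.mem_nhds hat, hc.eventually (hP x hx),
      hc.eventually ((hU x).2.mem_nhds (hU x).1)] with y e1 e2 e3
    refine ⟨?_, e2, e3⟩
    nth_rewrite 1 [(he x).2]
    exact (e x).right_inv e1
  filter_upwards [h1] with y hy hcard
  refine ⟨fun x => (e x).symm y, ?_, fun x hx => (hy x hx).2.1⟩
  have hmaps : MapsTo (fun x => (e x).symm y) (F ⁻¹' {a}) (F ⁻¹' {y}) := fun x hx => (hy x hx).1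
  have hinj : InjOn (fun x => (e x).symm y) (F ⁻¹' {a}) := by
    intro x hx x' hx' h
    by_contra hne
    refine disjoint_left.1 (hdisj hx hx' hne) (hy x hx).2.2 ?_
    have h' : (e x).symm y = (e x').symm y := h
    rw [h']
    exact (hy x' hx').2.2
  refine ⟨hmaps, hinj, ?_⟩
  have himg : (fun x => (e x).symm y) '' (F ⁻¹' {a}) = F ⁻¹' {y} :=
    (hfin.image _).eq_of_subset_of_encard_le hmaps.image_subset (by rw [hinj.encard_image, hcard])
  exact himg.symm.subset

end Sheets

end

/-! ### Local geometry along `D₀`, the jump function and the fibre sum. -/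

section

open Set Filter Module

section HalfSpace

variable {n : ℕ}

theorem starConvex_ball_diff_halfSpace (y : Eucl n) {r : ℝ} {i j : Fin n} (hij : i ≠ j)
    (hr : 0 < r) (hi : y i = 0) (hj : y j = 0) :
    ∃ c, c ∈ Metric.ball y r \ {x | x i = 0 ∧ 0 ≤ x j} ∧
      StarConvex ℝ c (Metric.ball y r \ {x : Eucl n | x i = 0 ∧ 0 ≤ x j}) := by
  -- The centre lies in the hyperplane, on the far side of the edge. A segment from it that meets
  -- the hyperplane again stays inside it, and cannot reach the half space without ending there.
  set c : Eucl n := y - (r / 2) • EuclideanSpace.single j 1 with hc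
  have hcb : c ∈ Metric.ball y r := by
    rw [Metric.mem_ball, dist_eq_norm, hc, sub_sub_cancel_left, norm_neg, norm_smul,
      PiLp.norm_single, norm_one, mul_one, Real.norm_of_nonneg (by positivity)]
    linarith
  have hci : c i = 0 := by simp [hc, hi, hij]
  have hcj : c j = -(r / 2) := by simp [hc, hj]
  refine ⟨c, ⟨hcb, fun h => ?_⟩, ?_⟩
  · have := h.2
    linarith
  · intro z hz a t ha ht hat
    refine ⟨convex_ball y r hcb hz.1 ha ht hat, fun h => ?_⟩
    have h1 : (a • c + t • z) i = t * z i := by simp [hci]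
    have h2 : (a • c + t • z) j = a * -(r / 2) + t * z j := by simp [hcj]
    obtain ⟨e1, e2⟩ := h
    rw [h1] at e1
    rw [h2] at e2
    rcases ht.eq_or_lt with h0 | h0
    · rw [← h0] at e2 hat
      nlinarith
    · have hzi : z i = 0 := by
        rcases mul_eq_zero.1 e1 with h | h
        · exact absurd h h0.ne'
        · exact h
      refine hz.2 ⟨hzi, ?_⟩
      by_contra hneg
      rw [not_le] at hneg
      nlinarith [mul_pos_of_neg_of_neg hneg (neg_lt_zero.2 h0), mul_nonneg ha hr.le]

theorem IsHalfSpaceAlong.exists_isPreconnected_diff {B D₀ : Set (Eucl n)}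
    (h : IsHalfSpaceAlong B D₀) {p : Eucl n} (hp : p ∈ D₀) {N : Set (Eucl n)} (hN : N ∈ 𝓝 p) :
    ∃ V, IsOpen V ∧ p ∈ V ∧ V ⊆ N ∧ IsPreconnected (V \ B) := by
  obtain ⟨Φ, -, hps, i, j, hij, hB, hD⟩ := h p hp
  have hpt := Φ.map_source hps
  have h1 : ∀ᶠ y in 𝓝 (Φ p), y ∈ Φ.target ∧ Φ.symm y ∈ N := by
    refine Eventually.and (Φ.open_target.mem_nhds hpt) ((Φ.continuousAt_symm hpt).eventually ?_)
    rwa [Φ.left_inv hps]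
  obtain ⟨r, hr, hball⟩ := Metric.eventually_nhds_iff_ball.1 h1
  have hsub : Metric.ball (Φ p) r ⊆ Φ.symm.source := fun y hy => (hball y hy).1
  refine ⟨Φ.symm '' Metric.ball (Φ p) r, Φ.symm.isOpen_image_of_subset_source Metric.isOpen_ball
    hsub, ⟨Φ p, Metric.mem_ball_self hr, Φ.left_inv hps⟩, ?_, ?_⟩
  · rintro _ ⟨y, hy, rfl⟩
    exact (hball y hy).2
  · obtain ⟨hi, hj⟩ := (hD p hps).1 hp
    obtain ⟨c, hc, hstar⟩ := starConvex_ball_diff_halfSpace (Φ p) hij hr hi hj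
    have himg : (Φ.symm '' Metric.ball (Φ p) r) \ B =
        Φ.symm '' (Metric.ball (Φ p) r \ {x | x i = 0 ∧ 0 ≤ x j}) := by
      have hiff : ∀ y ∈ Metric.ball (Φ p) r, Φ.symm y ∈ B ↔ y i = 0 ∧ 0 ≤ y j := by
        intro y hy
        rw [hB _ (Φ.map_target (hsub hy)), Φ.right_inv (hsub hy)]
      ext x
      constructor
      · rintro ⟨⟨y, hy, rfl⟩, hx⟩
        exact ⟨y, ⟨hy, fun h => hx ((hiff y hy).2 h)⟩, rfl⟩
      · rintro ⟨y, ⟨hy, hx⟩, rfl⟩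
        exact ⟨⟨y, hy, rfl⟩, fun h => hx ((hiff y hy).1 h)⟩
    rw [himg]
    exact (hstar.isPathConnected hc).isConnected.isPreconnected.image _
      (Φ.continuousOn_symm.mono fun y hy => hsub hy.1)

theorem IsHalfSpaceAlong.isClosed_closure_diff {B D₀ : Set (Eucl n)} (h : IsHalfSpaceAlong B D₀) :
    IsClosed (closure D₀ \ D₀) := by
  refine isClosed_of_closure_subset fun x hx => ?_
  have hxD : x ∈ closure D₀ := closure_minimal sdiff_subset isClosed_closure hx
  refine ⟨hxD, fun hx0 => ?_⟩
  obtain ⟨Φ, -, hps, i, j, -, -, hD⟩ := h x hx0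
  obtain ⟨z, hzs, hzcl, hz0⟩ := mem_closure_iff.1 hx _ Φ.open_source hps
  have hcoord : ∀ k, (∀ w ∈ Φ.source, w ∈ D₀ → Φ w k = 0) → Φ z k = 0 := by
    intro k hk
    by_contra hne
    have hc : ContinuousAt (fun w => Φ w k) z :=
      (EuclideanSpace.proj k : Eucl n →L[ℝ] ℝ).continuous.continuousAt.comp (Φ.continuousAt hzs)
    have hev : ∀ᶠ w in 𝓝 z, Φ w k ≠ 0 ∧ w ∈ Φ.source :=
      (hc.eventually (isOpen_ne.mem_nhds hne)).and (Φ.open_source.mem_nhds hzs)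
    obtain ⟨w, ⟨h1, h2⟩, h3⟩ := mem_closure_iff_nhds.1 hzcl _ hev
    exact h1 (hk w h2 h3)
  exact hz0 ((hD z hzs).2 ⟨hcoord i fun w hw hw0 => ((hD w hw).1 hw0).1,
    hcoord j fun w hw hw0 => ((hD w hw).1 hw0).2⟩)

theorem CodimAtLeast.dimH_lt {c k : ℕ} {S : Set (Eucl n)} (h : CodimAtLeast c S) (hS : S.Nonempty)
    (hk : k < c) : dimH S + k < (finrank ℝ (Eucl n) : ℕ) := by
  rcases h with rfl | h
  · exact absurd hS (by simp)
  · rw [finrank_euclideanSpace, Fintype.card_fin]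
    refine lt_of_lt_of_le ?_ h
    exact ENNReal.add_lt_add_left (Real.dimH_ne_top S) (by exact_mod_cast hk)

end HalfSpace

section Degree

variable {X : Type u} [TopologicalSpace X] {n : ℕ} {F : X → Eucl n} {A D : Set (Eucl n)}
  {b : Eucl n} {l lp lm : X → X} {ρ : Eucl n → Eucl n → ℝ}

open Classical in
/-- The indicator of the sheet with label `i`. -/
noncomputable def sheetIndicator (l : X → X) (i z : X) : ℤ := if l z = i then 1 else 0

theorem IsCoorientation.eventually_mem_compl_closure (hD : IsClosed D) (hAD : D = closure A \ A)
    {p : Eucl n} (hp : p ∈ A) : ∀ᶠ q in 𝓝 p, q ∉ A → q ∈ (closure A)ᶜ := by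
  have hpD : p ∈ Dᶜ := fun h => by
    rw [hAD] at h
    exact h.2 hp
  filter_upwards [hD.isOpen_compl.mem_nhds hpD] with q hq hqA hqc
  exact hq (hAD ▸ ⟨hqc, hqA⟩)

theorem IsCoorientation.dense_compl_closure (hρ : IsCoorientation A ρ) (hD : IsClosed D)
    (hAD : D = closure A \ A) (hD2 : CodimAtLeast 2 D) : Dense (closure A)ᶜ := by
  have hDd : Dense Dᶜ := by
    rcases D.eq_empty_or_nonempty with rfl | hne
    · simp
    · exact dense_compl_of_dimH_lt_finrank (by simpa using hD2.dimH_lt hne (k := 0) (by norm_num))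
  refine dense_closure.1 (hDd.mono fun x hx => ?_)
  by_cases hxA : x ∈ A
  · refine mem_closure_iff_frequently.2 ?_
    obtain ⟨V, hVo, hxV, -, hVA, -⟩ := hρ.twoSided x hxA univ univ_mem
    have h1 := (IsCoorientation.eventually_mem_compl_closure hD hAD hxA).and (hVo.mem_nhds hxV)
    refine ((hρ.twoSided x hxA).frequently.1.and_eventually h1).mono ?_
    rintro z ⟨hz, hz1, hzV⟩
    exact hz1 fun hzA => hz.ne' ((hVA z hzV).1 hzA)
  · refine subset_closure fun hxc => hx ?_
    rw [hAD]
    exact ⟨hxc, hxA⟩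

theorem subsingleton_fiber_of_side_labels_eq [ConnectedSpace X] (hF : IsLocalHomeomorph F)
    (hD : IsClosed D) (hD2 : CodimAtLeast 2 D) (hAD : D = closure A \ A)
    (hl : IsSheetLabel F (closure A)ᶜ b l) (hb : b ∈ (closure A)ᶜ) (hρ : IsCoorientation A ρ)
    (hlpm : ∀ x, F x ∈ A → ∀ᶠ z in 𝓝 x, (0 < ρ (F x) (F z) → F z ∈ (closure A)ᶜ ∧ l z = lp x) ∧
      (ρ (F x) (F z) < 0 → F z ∈ (closure A)ᶜ ∧ l z = lm x))
    (heq : ∀ x, F x ∈ A → lp x = lm x) : (F ⁻¹' {b}).Subsingleton := by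
  set Y := F ⁻¹' (closure A)ᶜ with hYdef
  have hY : Dense Y := (hρ.dense_compl_closure hD hAD hD2).preimage hF.isOpenMap
  have hYD : ∀ y ∈ Y, F y ∉ D := fun y hy h => by
    rw [hAD] at h
    exact hy h.1
  intro z hz w hw
  have hz' : F z = b := hz
  have hw' : F w = b := hw
  have h1 : ∀ y, F y ∉ D → AgreesAt Y (sheetIndicator l (l z)) 0 y := by
    intro y hy
    by_cases hyA : F y ∈ A
    · obtain ⟨V, hVo, hyV, -, hVA, -⟩ := hρ.twoSided _ hyA univ univ_mem
      refine ⟨sheetIndicator id (l z) (lp y), ?_⟩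
      filter_upwards [mem_nhdsWithin_of_mem_nhds (hlpm y hyA), self_mem_nhdsWithin,
        mem_nhdsWithin_of_mem_nhds (hF.continuous.continuousAt.preimage_mem_nhds
          (hVo.mem_nhds hyV))] with x h1 h2 h3
      -- Both sides of `A` carry the same label here, so the indicator has no jump.
      have hxA : F x ∉ A := fun h => h2 (subset_closure h)
      have hlx : l x = lp y := by
        rcases lt_trichotomy (ρ (F y) (F x)) 0 with h | h | h
        · rw [heq y hyA, (h1.2 h).2]
        · exact absurd ((hVA _ h3).2 h) hxA
        · exact (h1.1 h).2
      simp only [sheetIndicator, Pi.zero_apply, sub_zero, id]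
      rw [hlx]
    · have hyC : F y ∈ (closure A)ᶜ := fun h => hy (by rw [hAD]; exact ⟨h, hyA⟩)
      refine ⟨sheetIndicator l (l z) y, ?_⟩
      filter_upwards [mem_nhdsWithin_of_mem_nhds (hl.eventually_eq y hyC)] with x hx
      simp only [sheetIndicator, Pi.zero_apply, sub_zero]
      rw [hx]
  have h2 : ∀ y, AgreesAt Y (sheetIndicator l (l z)) 0 y := by
    intro y
    by_cases hy : F y ∈ D
    · exact agreesAt_of_dimH_lt hF hD (by simpa using hD2.dimH_lt ⟨_, hy⟩ (k := 1) (by norm_num))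
        hY hYD (.of_forall h1)
    · exact h1 y hy
  obtain ⟨c, hc⟩ := exists_sub_eq_of_agreesAt hY isPreconnected_univ fun y _ => h2 y
  have hzY : z ∈ Y := by
    change F z ∈ (closure A)ᶜ
    rwa [hz']
  have hwY : w ∈ Y := by
    change F w ∈ (closure A)ᶜ
    rwa [hw']
  have h3 := (hc z (mem_univ z) hzY).trans (hc w (mem_univ w) hwY).symm
  refine ((hl.bijOn b hb).injOn hz hw ?_)
  by_contra hne
  have hne' : l w ≠ l z := fun h => hne h.symm
  simp [sheetIndicator, hne'] at h3

/-- If the labels differed at `x₀`, a function with unit jump exactly across `T` would have fibre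
sums that both change and stay constant across `A`. -/
theorem side_labels_eq_of_homology [T2Space X] [PathConnectedSpace X] [LocallyPathConnectedSpace X]
    (hX : FirstHomologyVanishes X) (hF : IsLocalHomeomorph F)
    (hD : IsClosed D) (hD2 : CodimAtLeast 2 D) (hAD : NicelyBounds A D)
    (hl : IsSheetLabel F (closure A)ᶜ b l) (hb : b ∈ (closure A)ᶜ) (hρ : IsCoorientation A ρ)
    (hlpm : ∀ x, F x ∈ A → ∀ᶠ z in 𝓝 x, (0 < ρ (F x) (F z) → F z ∈ (closure A)ᶜ ∧ l z = lp x) ∧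
      (ρ (F x) (F z) < 0 → F z ∈ (closure A)ᶜ ∧ l z = lm x))
    {d : ℕ∞} (hd : d ≠ ⊤) (hsheets : ∀ y ∉ D, (F ⁻¹' {y}).encard = d) {x₀ : X} (hx₀ : F x₀ ∈ A) :
    lp x₀ = lm x₀ := by
  classical
  by_contra hne
  set Y := F ⁻¹' (closure A)ᶜ with hYdef
  have hYo : IsOpen Y := isClosed_closure.isOpen_compl.preimage hF.continuous
  have hADeq := hAD.boundary_eq
  have hY : Dense Y := (hρ.dense_compl_closure hD hADeq hD2).preimage hF.isOpenMap
  have hCD : ∀ y ∈ (closure A)ᶜ, y ∉ D := fun y hy h => by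
    rw [hADeq] at h
    exact hy h.1
  have hAnD : ∀ y ∈ A, y ∉ D := fun y hy h => by
    rw [hADeq] at h
    exact h.2 hy
  have hcases : ∀ y, y ∉ A → y ∉ D → y ∈ (closure A)ᶜ := fun y h1 h2 h3 =>
    h2 (by rw [hADeq]; exact ⟨h3, h1⟩)
  obtain ⟨D₀, -, hDcl, hcod, hhalf⟩ := hAD.regular_part
  set S := D \ D₀ with hS
  have hSc : IsClosed S := by
    rw [hS, hDcl]
    exact hhalf.isClosed_closure_diff
  set i := lp x₀ with hi
  set T : Set X := {x | F x ∈ A ∧ lp x = i ∧ lm x ≠ i} with hT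
  have hlocal := fun x (hx : F x ∈ A) => side_labels_eventually_eq hF hρ hlpm hx
  -- outside the singular locus, `T` is closed
  have hTclosed : ∀ x, F x ∉ S → x ∉ T → ∀ᶠ y in 𝓝 x, y ∉ T := by
    intro x hxS hxT
    by_cases hxA : F x ∈ A
    · filter_upwards [hlocal x hxA] with y hy hyT
      obtain ⟨e1, e2⟩ := hy hyT.1
      exact hxT ⟨hxA, e1 ▸ hyT.2.1, e2 ▸ hyT.2.2⟩
    by_cases hxD : F x ∈ D
    · have hxD0 : F x ∈ D₀ := by
        by_contra h
        exact hxS ⟨hxD, h⟩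
      obtain ⟨e, hxe, rfl⟩ := hF x
      obtain ⟨V, hVo, hxV, hVe, hpre⟩ := hhalf.exists_isPreconnected_diff hxD0
        (e.open_target.mem_nhds (e.map_source hxe))
      have hconst : ∃ c, ∀ᶠ z in 𝓝 x, e z ∈ (closure A)ᶜ → l z = c := by
        rcases (V \ closure A).eq_empty_or_nonempty with hemp | ⟨q, hq⟩
        · refine ⟨x, ?_⟩
          filter_upwards [(e.continuousAt hxe).preimage_mem_nhds (hVo.mem_nhds hxV)] with z hz hzc
          exact absurd (show e z ∈ V \ closure A from ⟨hz, hzc⟩) (by simp [hemp])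
        · refine ⟨l (e.symm q), ?_⟩
          filter_upwards [(e.continuousAt hxe).preimage_mem_nhds (hVo.mem_nhds hxV),
            e.open_source.mem_nhds hxe] with z hz hze hzc
          refine (hpre.image _ (e.continuousOn_symm.mono fun y hy => hVe hy.1)).eq_of_eventually_eq
            (f := l) ?_ ⟨e z, ⟨hz, hzc⟩, e.left_inv hze⟩ ⟨q, hq, rfl⟩
          rintro _ ⟨y, hy, rfl⟩
          refine hl.eventually_eq _ ?_
          rw [e.right_inv (hVe hy.1)]
          exact hy.2
      obtain ⟨c, hc⟩ := hconst
      filter_upwards [side_labels_eq_of_eventually_const hF hρ hlpm hc] with y hy hyT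
      exact hyT.2.2 ((hy hyT.1).symm.trans hyT.2.1)
    · filter_upwards [hYo.mem_nhds (show x ∈ Y from hcases _ hxA hxD)] with y hy hyT
      exact hy (subset_closure hyT.1)
  -- Near a point of `T` the indicator of sheet `i` is 1 on the positive side and 0 on the negative:
  -- the local model of a unit jump.
  let h : X → X → ℤ := fun x => if x ∈ T then sheetIndicator l i else 0
  have hh : ∀ x, F x ∉ S → ∀ᶠ y in 𝓝 x, AgreesAt Y (h x) (h y) y := by
    intro x hxS
    by_cases hxT : x ∈ T
    · have hDo : ∀ᶠ y in 𝓝 x, F y ∉ D :=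
        hF.continuous.continuousAt.eventually (hD.isOpen_compl.mem_nhds (hAnD _ hxT.1))
      filter_upwards [hlocal x hxT.1, hDo] with y hy hyD
      by_cases hyT : y ∈ T
      · simp only [h, hxT, hyT, if_true]
        exact .refl _ _ _
      · have hyA : F y ∉ A := fun hyA => by
          obtain ⟨e1, e2⟩ := hy hyA
          exact hyT ⟨hyA, e1.trans hxT.2.1, fun e => hxT.2.2 (e2.symm.trans e)⟩
        simp only [h, hxT, hyT, if_true, if_false]
        refine ⟨sheetIndicator l i y, ?_⟩
        filter_upwards [mem_nhdsWithin_of_mem_nhds (hl.eventually_eq y (hcases _ hyA hyD))]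
          with z hz
        simp [sheetIndicator, hz]
    · filter_upwards [hTclosed x hxS hxT] with y hyT
      simp only [h, hxT, hyT, if_false]
      exact .refl _ _ _
  obtain ⟨H, hH⟩ := exists_agreesAt_of_homology_of_dimH hX hF hSc
    (fun hne => by exact_mod_cast hcod.dimH_lt hne (k := 2) (by norm_num)) hY
    (fun y hy hyS => hCD _ hy hyS.1) hh
  have hHloc : ∀ z, F z ∈ (closure A)ᶜ → ∀ᶠ w in 𝓝 z, H w = H z := by
    intro z hz
    have hzT : z ∉ T := fun h => hz (subset_closure h.1)
    obtain ⟨c, hc⟩ := hH z fun hzS => hCD _ hz hzS.1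
    simp only [h, hzT, if_false] at hc
    rw [hYo.nhdsWithin_eq (show z ∈ Y from hz)] at hc
    have hcz := hc.self_of_nhds
    filter_upwards [hc] with w hw
    simp only [Pi.zero_apply, sub_zero] at hw hcz
    exact hw.trans hcz.symm
  -- the sum of `H` over a fibre does not depend on the fibre
  have hsum : ∀ y ∈ (closure A)ᶜ, ∑ᶠ z ∈ F ⁻¹' {y}, H z = ∑ᶠ z ∈ F ⁻¹' {b}, H z := by
    intro y hy
    refine finsum_mem_eq_of_bijOn l (hl.bijOn y hy) fun z hz => ?_
    have hz' : F z = y := hz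
    have hlz : F (l z) = b := (hl.bijOn y hy).mapsTo hz
    exact hl.const H hHloc z (l z) (hz' ▸ hy) (hlz ▸ hb) (hl.apply_self _ hlz).symm
  set a := F x₀ with ha
  have hfin : (F ⁻¹' {a}).Finite := by
    rw [← encard_lt_top_iff, hsheets a (hAnD a hx₀)]
    exact lt_top_iff_ne_top.2 hd
  have hc : ∀ x ∈ F ⁻¹' {a}, ∃ c : ℤ, ∀ᶠ z in 𝓝 x, z ∈ Y → H z - h x z = c := by
    intro x hx
    have hx' : F x = a := hx
    obtain ⟨c, hc⟩ := hH x fun hxS => hAnD a hx₀ (hx' ▸ hxS.1)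
    exact ⟨c, eventually_nhdsWithin_iff.1 hc⟩
  choose! c hc using hc
  -- Fibres on either side of `A` are matched with the fibre over `a`, keeping track of the constant
  -- in `H - h x` and of the side label.
  have hP := hF.eventually_exists_bijOn_fiber hfin (P := fun x z =>
    (z ∈ Y → H z - h x z = c x) ∧ (0 < ρ a (F z) → l z = lp x) ∧ (ρ a (F z) < 0 → l z = lm x)) (by
      intro x hx
      have hx' : F x = a := hx
      have h1 := hlpm x (by rw [hx']; exact hx₀)
      rw [hx'] at h1
      filter_upwards [hc x hx, h1] with z e1 e2
      exact ⟨e1, fun h => (e2.1 h).2, fun h => (e2.2 h).2⟩)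
  obtain ⟨V, hVo, haV, -, hVA, -⟩ := hρ.twoSided a hx₀ univ univ_mem
  have hQ := (hP.and (IsCoorientation.eventually_mem_compl_closure hD hADeq hx₀)).and
    (hVo.mem_nhds haV)
  obtain ⟨hfp, hfm⟩ := (hρ.twoSided a hx₀).frequently
  obtain ⟨yp, hyp, ⟨hP1, hC1⟩, hV1⟩ := (hfp.and_eventually hQ).exists
  obtain ⟨ym, hym, ⟨hP2, hC2⟩, hV2⟩ := (hfm.and_eventually hQ).exists
  have hypC := hC1 fun h => hyp.ne' ((hVA _ hV1).1 h)
  have hymC := hC2 fun h => hym.ne ((hVA _ hV2).1 h)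
  obtain ⟨ψp, hψp, hψp'⟩ := hP1 ((hsheets _ (hCD _ hypC)).trans (hsheets _ (hAnD a hx₀)).symm)
  obtain ⟨ψm, hψm, hψm'⟩ := hP2 ((hsheets _ (hCD _ hymC)).trans (hsheets _ (hAnD a hx₀)).symm)
  have hdiff : ∀ x ∈ F ⁻¹' {a}, H (ψp x) - H (ψm x) = if x ∈ T then 1 else 0 := by
    intro x hx
    have hFp : F (ψp x) = yp := hψp.mapsTo hx
    have hFm : F (ψm x) = ym := hψm.mapsTo hx
    obtain ⟨e1, e2, -⟩ := hψp' x hx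
    obtain ⟨e3, -, e4⟩ := hψm' x hx
    have e1 := e1 (show F (ψp x) ∈ (closure A)ᶜ by rwa [hFp])
    have e3 := e3 (show F (ψm x) ∈ (closure A)ᶜ by rwa [hFm])
    have e2 := e2 (by rwa [hFp])
    have e4 := e4 (by rwa [hFm])
    by_cases hxT : x ∈ T
    · have e5 : h x (ψp x) = 1 := by simp [h, hxT, sheetIndicator, e2, hxT.2.1]
      have e6 : h x (ψm x) = 0 := by simp [h, hxT, sheetIndicator, e4, hxT.2.2]
      rw [if_pos hxT]
      omega
    · have e5 : h x (ψp x) = 0 := by simp [h, hxT]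
      have e6 : h x (ψm x) = 0 := by simp [h, hxT]
      rw [if_neg hxT]
      omega
  have hsp : ∑ᶠ x ∈ F ⁻¹' {a}, H (ψp x) = ∑ᶠ z ∈ F ⁻¹' {b}, H z :=
    (finsum_mem_eq_of_bijOn ψp hψp fun _ _ => rfl).trans (hsum yp hypC)
  have hsm : ∑ᶠ x ∈ F ⁻¹' {a}, H (ψm x) = ∑ᶠ z ∈ F ⁻¹' {b}, H z :=
    (finsum_mem_eq_of_bijOn ψm hψm fun _ _ => rfl).trans (hsum ym hymC)
  -- The difference of the two fibre sums counts the points of `T` over `a`, among them `x₀`.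
  have hzero : ∑ x ∈ hfin.toFinset, (if x ∈ T then (1 : ℤ) else 0) = 0 := by
    rw [finsum_mem_eq_finite_toFinset_sum _ hfin] at hsp hsm
    rw [← Finset.sum_congr rfl fun x hx => hdiff x (hfin.mem_toFinset.1 hx),
      Finset.sum_sub_distrib, hsp, hsm, sub_self]
  have hx₀T : x₀ ∈ T := ⟨hx₀, rfl, fun h => hne h.symm⟩
  have := (Finset.sum_eq_zero_iff_of_nonneg fun x _ => by split_ifs <;> norm_num).1 hzero x₀
    (hfin.mem_toFinset.2 rfl)
  simp [hx₀T] at this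

end Degree

end

theorem mainTheorem6 {n : ℕ} {X : Type*} [TopologicalSpace X] [T2Space X]
    [SecondCountableTopology X] [ChartedSpace (EuclideanSpace ℝ (Fin n)) X]
    [IsManifold (𝓡 n) ∞ X] [ConnectedSpace X] (hX : FirstHomologyVanishes X)
    (F : X → EuclideanSpace ℝ (Fin n)) (hF : IsLocalDiffeomorph (𝓡 n) (𝓡 n) ∞ F)
    (D : Set (EuclideanSpace ℝ (Fin n))) (hD : IsClosed D) (hD2 : CodimAtLeast 2 D)
    (d : ℕ∞) (hd : IsSheetedCoverAwayFrom F d D)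
    (A : Set (EuclideanSpace ℝ (Fin n))) (hA : IsSubmanifoldOfCodim 1 A)
    (hAo : IsOrientableSubmanifold (n - 1) A) (hAD : NicelyBounds A D)
    (hAc : SimplyConnectedSpace ↥((closure A)ᶜ)) :
    d = 1 ∨ d = ⊤ := by
  by_cases hdt : d = ⊤
  · exact Or.inr hdt
  refine Or.inl ?_
  have hFl : IsLocalHomeomorph F := hF.isLocalHomeomorph
  have : LocallyPathConnectedSpace X :=
    ChartedSpace.locallyPathConnectedSpace (EuclideanSpace ℝ (Fin n)) X
  have : PathConnectedSpace X := pathConnectedSpace_iff_connectedSpace.2 inferInstance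
  obtain ⟨ρ, hρ⟩ := exists_isCoorientation hA hAo
  have hCo : IsOpen (closure A)ᶜ := isClosed_closure.isOpen_compl
  have := hCo.locallyPathConnectedSpace
  have hCD : (closure A)ᶜ ⊆ Dᶜ := fun y hy h => by
    rw [hAD.boundary_eq] at h
    exact hy h.1
  obtain ⟨⟨b, hb⟩⟩ : Nonempty ↥((closure A)ᶜ) := inferInstance
  obtain ⟨l, hl⟩ := exists_isSheetLabel hFl hd.covering hCD hCo hb
  obtain ⟨lp, lm, hlpm⟩ := hl.exists_side_labels hFl hρ fun p hp =>
    IsCoorientation.eventually_mem_compl_closure hD hAD.boundary_eq hp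
  have heq : ∀ x, F x ∈ A → lp x = lm x := fun x hx =>
    side_labels_eq_of_homology hX hFl hD hD2 hAD hl hb hρ hlpm hdt hd.sheets hx
  have hsub := subsingleton_fiber_of_side_labels_eq hFl hD hD2 hAD.boundary_eq hl hb hρ hlpm heq
  have hY : Dense (F ⁻¹' (closure A)ᶜ) :=
    (hρ.dense_compl_closure hD hAD.boundary_eq hD2).preimage hFl.isOpenMap
  -- This excludes `d = 0`: some point lies over the complement of `closure A`, so the fibre over
  -- `b` is nonempty.
  obtain ⟨z, hz⟩ := hY.nonempty
  have hlz : l z ∈ F ⁻¹' {b} := (hl.bijOn (F z) hz).mapsTo rfl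
  rw [← hd.sheets b (hCD hb), Set.encard_eq_one]
  exact ⟨l z, hsub.eq_singleton_of_mem hlz⟩
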